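/- For an open set $\Omega\subset\mathbb{R}^3$ let $\dot H^1(\Omega)$ be the space of real functions $\phi\in L^1_{\rm loc}(\Omega)$ whose distributional gradient in $\Omega$ satisfies $\nabla\phi\in L^2(\Omega,\mathbb{R}^3)$, and for $F\in L^2(\Omega,\mathbb{R}^3)$ put $$|||F|||_{2\Omega}:=\inf_{\phi\in\dot H^1(\Omega)}\|F-\nabla\phi\|_{L^2(\Omega,\mathbb{R}^3)} .$$ Let $A_n$ ($n\in\mathbb{N}$) and $A$ be vector fields in $L^1_{\rm loc}(\mathbb{R}^3,\mathbb{R}^3)$ whose distributional curls $\nabla\wedge A_n$ and $\nabla\wedge A$ belong to $L^{3/2}(\mathbb{R}^3,\mathbb{R}^3)$, and suppose that $\nabla\wedge A_n\rightharpoonup\nabla\wedge A$ weakly in $L^{3/2}(\mathbb{R}^3,\mathbb{R}^3)$. Then for every open set $\Omega\subset\mathbb{R}^3$ of finite measure such that $A_n-A\in L^2(\Omega,\mathbb{R}^3)$ for all $n$ (which holds automatically if $A_n,A\in L^3(\mathbb{R}^3,\mathbb{R}^3)$), $$|||A_n-A|||_{2\Omega}\to 0\qquad\text{as } n\to\infty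 .$$ -/

import Mathlib

open MeasureTheory Filter Topology
open scoped ENNReal ContDiff

/-- Euclidean three-space `ℝ³`. -/
abbrev E3 : Type := EuclideanSpace ℝ (Fin 3)

/-- `3/2` is an admissible exponent, so that `L^{3/2}` is a normed space. -/
instance fact_one_le_three_halves : Fact ((1 : ℝ≥0∞) ≤ 3 / 2) :=
  ⟨by
    rw [ENNReal.le_div_iff_mul_le (Or.inl (by norm_num)) (Or.inl (by norm_num))]
    norm_num⟩

/-- The partial derivative `∂ᵢ f (x)` of a differentiable scalar function on `ℝ³`. -/
noncomputable def partialDeriv (i : Fin 3) (f : E3 → ℝ) (x : E3) : ℝ :=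
  fderiv ℝ f x (EuclideanSpace.single i 1)

/-- The classical curl `∇ ∧ Φ` of a differentiable vector field on `ℝ³`. -/
noncomputable def curl (Φ : E3 → E3) (x : E3) : E3 :=
  !₂[partialDeriv 1 (fun y => Φ y 2) x - partialDeriv 2 (fun y => Φ y 1) x,
     partialDeriv 2 (fun y => Φ y 0) x - partialDeriv 0 (fun y => Φ y 2) x,
     partialDeriv 0 (fun y => Φ y 1) x - partialDeriv 1 (fun y => Φ y 0) x]

/-- `∇ ∧ A = B` on `ℝ³` in the sense of distributions, for (locally integrable) vector fields
`A` and `B`: `∫ A · (∇ ∧ Φ) = ∫ B · Φ` for every test field `Φ ∈ C_c^∞(ℝ³, ℝ³)`. -/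
def HasWeakCurl (A B : E3 → E3) : Prop :=
  ∀ Φ : E3 → E3, ContDiff ℝ ∞ Φ → HasCompactSupport Φ →
    ∫ x, inner ℝ (A x) (curl Φ x) = ∫ x, inner ℝ (B x) (Φ x)

/-- `∇φ = G` on the open set `Ω` in the sense of distributions: `∫_Ω φ ∂ᵢη = -∫_Ω Gᵢ η` for every
`i` and every test function `η ∈ C_c^∞(Ω)`. -/
def HasWeakGradOn (Ω : Set E3) (φ : E3 → ℝ) (G : E3 → E3) : Prop :=
  ∀ η : E3 → ℝ, ContDiff ℝ ∞ η → HasCompactSupport η → tsupport η ⊆ Ω → ∀ i : Fin 3,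
    ∫ x in Ω, φ x * partialDeriv i η x = - ∫ x in Ω, G x i * η x

/-- `φ` belongs to the homogeneous Sobolev space `Ḣ¹(Ω)`, with weak gradient `G`: `φ` is in
`L¹_loc(Ω)`, and its distributional gradient in `Ω` is `G ∈ L²(Ω, ℝ³)`. -/
def IsDotH1WithGrad (Ω : Set E3) (φ : E3 → ℝ) (G : E3 → E3) : Prop :=
  LocallyIntegrableOn φ Ω ∧ MemLp G 2 (volume.restrict Ω) ∧ HasWeakGradOn Ω φ G

/-- The gauge-invariant local `L²` seminorm: the infimum of `‖F - ∇φ‖_{L²(Ω)}` over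
`φ ∈ Ḣ¹(Ω)`. It takes values in `[0, ∞]` and is finite for `F ∈ L²(Ω, ℝ³)`. -/
noncomputable def localGaugeSeminorm (Ω : Set E3) (F : E3 → E3) : ℝ≥0∞ :=
  ⨅ (φ : E3 → ℝ) (G : E3 → E3) (_ : IsDotH1WithGrad Ω φ G),
    eLpNorm (F - G) 2 (volume.restrict Ω)

/-! Put `D = A n - A₀` and let `C` be its weak curl. The Biot–Savart field `biotSavart C`, built
from convolutions with `z_j / (4π|z|³)`, has weak curl `C` because `C` is divergence free. Hence `D
- biotSavart C` is curl free on all of ℝ³, so it is a gradient, and on `Ω` this gradient is square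
integrable. Subtracting it leaves `biotSavart C`, so the seminorm of `D` is at most the `L²(Ω)` norm
of `biotSavart C` (`localGaugeSeminorm_le_eLpNorm_biotSavart`). No geometry of `Ω` enters, since the
potential is found on the whole space.

It remains to see that convolution with the kernel turns weak `L^{3/2}` convergence into strong `L²`
convergence on sets of finite measure (`tendsto_setLIntegral_newtonPot`). The kernel has size
`|z|⁻²`. Near the origin it lies in `L^{6/5}` with small norm, and Young's inequality `L^{6/5} *
L^{3/2} ⊆ L²` makes that part small uniformly in `n`. Away from the origin it lies in `L³`, the dual
of `L^{3/2}`, so the convolution tends to zero pointwise and stays bounded; dominated convergence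
then applies.

The two structural facts are `HasWeakCurl.biotSavart`, a weak form of `curl curl = grad div - Δ`,
and `HasWeakCurl.exists_primitive`, the Poincaré lemma for fields that are only locally integrable,
obtained from an averaged homotopy operator and mollification. -/

/-! ### Size and integrability of the kernel. -/

/-- The `j`-th component of the gradient of the (normalized) Newton kernel,
`z ↦ z_j / (4π |z|³)`. -/
noncomputable def newtonKernel (j : Fin 3) (z : E3) : ℝ :=
  ((volume : Measure E3).toSphere.real Set.univ)⁻¹ * (z j * (‖z‖ ^ 3)⁻¹)

theorem newtonKernel_neg (j : Fin 3) (z : E3) : newtonKernel j (-z) = -newtonKernel j z := by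
  simp [newtonKernel]

theorem measurable_newtonKernel (j : Fin 3) : Measurable (newtonKernel j) := by
  unfold newtonKernel
  fun_prop

theorem norm_newtonKernel_le (j : Fin 3) (z : E3) :
    ‖newtonKernel j z‖ ≤ ((volume : Measure E3).toSphere.real Set.univ)⁻¹ * ‖z‖ ^ (-2 : ℝ) := by
  have h0 : 0 ≤ ((volume : Measure E3).toSphere.real Set.univ)⁻¹ := by positivity
  rw [newtonKernel, norm_mul, Real.norm_of_nonneg h0]
  gcongr
  -- At the origin both sides are `0`, by the conventions for inverses and for real powers of `0`.
  rcases eq_or_ne z 0 with rfl | hz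
  · simp
  have hz' : 0 < ‖z‖ := norm_pos_iff.2 hz
  rw [norm_mul, Real.norm_of_nonneg (by positivity : 0 ≤ (‖z‖ ^ 3)⁻¹), Real.rpow_neg hz'.le]
  calc ‖z j‖ * (‖z‖ ^ 3)⁻¹ ≤ ‖z‖ * (‖z‖ ^ 3)⁻¹ := by
        gcongr
        exact PiLp.norm_apply_le z j
    _ = (‖z‖ ^ (2 : ℝ))⁻¹ := by
        rw [Real.rpow_ofNat]
        field_simp

theorem integrableOn_ball_norm_rpow {s : ℝ} (hs : -3 < s) {r : ℝ} (hr : 0 < r) :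
    IntegrableOn (fun z : E3 => ‖z‖ ^ s) (Metric.ball 0 r) := by
  refine (integrableOn_fun_norm_addHaar (volume : Measure E3) (f := fun y : ℝ => y ^ s)).2 ?_
  -- The polar Jacobian `y²` shifts the exponent from `s` to `s + 2`.
  have h := (intervalIntegral.integrableOn_Ioo_rpow_iff (s := s + 2) hr).2 (by linarith)
  refine h.congr_fun (fun y hy => ?_) measurableSet_Ioo
  simp only [finrank_euclideanSpace, Fintype.card_fin, smul_eq_mul]
  rw [Real.rpow_add hy.1, mul_comm]
  norm_num

theorem integrableOn_compl_ball_norm_rpow {s : ℝ} (hs : s < -3) {r : ℝ} (hr : 0 < r) :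
    IntegrableOn (fun z : E3 => ‖z‖ ^ s) (Metric.ball 0 r)ᶜ := by
  rw [← integrable_indicator_iff measurableSet_ball.compl]
  have key := (integrable_fun_norm_addHaar (volume : Measure E3)
    (f := (Set.Ici r).indicator (fun y : ℝ => y ^ s))).2 ?_
  · refine key.congr (Eventually.of_forall fun z => ?_)
    by_cases h : r ≤ ‖z‖ <;> simp [Set.indicator, h]
  have h := (integrableOn_Ioi_rpow_of_lt (a := s + 2) (by linarith) hr)
  rw [← integrableOn_Ici_iff_integrableOn_Ioi] at h
  have h2 := (integrable_indicator_iff measurableSet_Ici).2 h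
  refine h2.integrableOn.congr_fun (fun y hy => ?_) measurableSet_Ioi
  have hy : 0 < y := hy
  by_cases h : r ≤ y
  · simp only [finrank_euclideanSpace, Fintype.card_fin, smul_eq_mul, Set.indicator, Set.mem_Ici, h,
      if_true]
    rw [Real.rpow_add hy, mul_comm]
    norm_num
  · simp [h]

theorem enorm_newtonKernel_rpow_le (j : Fin 3) (z : E3) {p : ℝ} (hp : 0 ≤ p) :
    ‖newtonKernel j z‖ₑ ^ p ≤
      ENNReal.ofReal (((volume : Measure E3).toSphere.real Set.univ)⁻¹ ^ p) *
        ENNReal.ofReal (‖z‖ ^ (-2 * p)) := by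
  have h0 : 0 ≤ ((volume : Measure E3).toSphere.real Set.univ)⁻¹ := by positivity
  rw [← ofReal_norm, ENNReal.ofReal_rpow_of_nonneg (norm_nonneg _) hp,
    ← ENNReal.ofReal_mul (by positivity), Real.rpow_mul (norm_nonneg _),
    ← Real.mul_rpow h0 (by positivity)]
  gcongr
  exact norm_newtonKernel_le j z

theorem setLIntegral_newtonKernel_rpow_lt_top (j : Fin 3) {p : ℝ} (hp : 0 ≤ p) {S : Set E3}
    (h : IntegrableOn (fun z : E3 => ‖z‖ ^ (-2 * p)) S) :
    ∫⁻ z in S, ‖newtonKernel j z‖ₑ ^ p < ⊤ := by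
  refine (lintegral_mono fun z => enorm_newtonKernel_rpow_le j z hp).trans_lt ?_
  rw [lintegral_const_mul' _ _ ENNReal.ofReal_ne_top]
  exact ENNReal.mul_lt_top ENNReal.ofReal_lt_top h.lintegral_lt_top

/-- The power `|z|^{-12/5}` is integrable at the origin in dimension three. The exponent `6/5` is
forced by Young's inequality: `5/6 + 2/3 = 1 + 1/2`. -/
theorem lintegral_ball_newtonKernel_lt_top (j : Fin 3) {r : ℝ} (hr : 0 < r) :
    ∫⁻ z in Metric.ball 0 r, ‖newtonKernel j z‖ₑ ^ (6 / 5 : ℝ) < ⊤ :=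
  setLIntegral_newtonKernel_rpow_lt_top j (by norm_num)
    (integrableOn_ball_norm_rpow (by norm_num) hr)

/-- The power `|z|⁻⁶` is integrable at infinity; `3` is the exponent dual to `3/2`. -/
theorem lintegral_compl_ball_newtonKernel_lt_top (j : Fin 3) {r : ℝ} (hr : 0 < r) :
    ∫⁻ z in (Metric.ball 0 r)ᶜ, ‖newtonKernel j z‖ₑ ^ (3 : ℝ) < ⊤ :=
  setLIntegral_newtonKernel_rpow_lt_top j (by norm_num)
    (integrableOn_compl_ball_norm_rpow (by norm_num) hr)

theorem locallyIntegrable_newtonKernel (j : Fin 3) : LocallyIntegrable (newtonKernel j) := by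
  intro x
  have hr : 0 < ‖x‖ + 1 := by positivity
  refine ⟨Metric.ball 0 (‖x‖ + 1), Metric.isOpen_ball.mem_nhds (by simp), ?_⟩
  refine ⟨(measurable_newtonKernel j).aestronglyMeasurable, ?_⟩
  have := setLIntegral_newtonKernel_rpow_lt_top j zero_le_one
    (integrableOn_ball_norm_rpow (s := -2 * 1) (by norm_num) hr)
  simpa [HasFiniteIntegral] using this

/-- The part of the kernel near the origin is small in `L^{6/5}`. -/
theorem tendsto_lintegral_ball_newtonKernel (j : Fin 3) :
    Tendsto (fun k : ℕ => ∫⁻ z in Metric.ball 0 (1 / ((k : ℝ) + 1)),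
      ‖newtonKernel j z‖ₑ ^ (6 / 5 : ℝ)) atTop (𝓝 0) := by
  have hsub : ∀ k : ℕ, Metric.ball (0 : E3) (1 / ((k : ℝ) + 1)) ⊆ Metric.ball 0 1 := fun k => by
    apply Metric.ball_subset_ball
    rw [div_le_one (by positivity)]
    linarith [(Nat.cast_nonneg k : (0 : ℝ) ≤ k)]
  have hvol : Tendsto (fun k : ℕ => (volume.restrict (Metric.ball (0 : E3) 1))
      (Metric.ball (0 : E3) (1 / ((k : ℝ) + 1)))) atTop (𝓝 0) := by
    have h1 : ∀ k : ℕ, (volume.restrict (Metric.ball (0 : E3) 1))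
        (Metric.ball (0 : E3) (1 / ((k : ℝ) + 1))) =
        ENNReal.ofReal ((1 / ((k : ℝ) + 1)) ^ 3) * volume (Metric.ball (0 : E3) 1) := fun k => by
      rw [Measure.restrict_apply measurableSet_ball, Set.inter_eq_left.2 (hsub k),
        Measure.addHaar_ball _ _ (by positivity)]
      simp
    simp_rw [h1]
    have h2 : Tendsto (fun k : ℕ => ENNReal.ofReal ((1 / ((k : ℝ) + 1)) ^ 3)) atTop (𝓝 0) := by
      have := ENNReal.tendsto_ofReal ((tendsto_one_div_add_atTop_nhds_zero_nat (𝕜 := ℝ)).pow 3)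
      simpa using this
    simpa using ENNReal.Tendsto.mul_const h2 (Or.inr
      (measure_ball_lt_top (μ := (volume : Measure E3)) (x := 0) (r := 1)).ne)
  -- Absolute continuity of the integral, on balls whose volume shrinks to zero.
  have := tendsto_setLIntegral_zero (μ := volume.restrict (Metric.ball (0 : E3) 1))
    (lintegral_ball_newtonKernel_lt_top j one_pos).ne hvol
  refine this.congr fun k => ?_
  rw [Measure.restrict_restrict measurableSet_ball, Set.inter_eq_left.2 (hsub k)]

/-! ### Convolution inequalities. -/

/-- Young's convolution inequality `L^{3/2} * L^{6/5} ⊆ L²`, for nonnegative functions. -/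
theorem lintegral_sq_convolution_le {f g : E3 → ℝ≥0∞} (hf : AEMeasurable f) (hg : Measurable g) :
    ∫⁻ x, (∫⁻ y, g (x - y) * f y) ^ (2 : ℝ) ≤
      (∫⁻ y, f y ^ (3 / 2 : ℝ)) ^ (4 / 3 : ℝ) * (∫⁻ y, g y ^ (6 / 5 : ℝ)) ^ (5 / 3 : ℝ) := by
  set a := ∫⁻ y, f y ^ (3 / 2 : ℝ) with ha
  set b := ∫⁻ y, g y ^ (6 / 5 : ℝ) with hb
  have htrans : ∀ x : E3, ∫⁻ y, g (x - y) ^ (6 / 5 : ℝ) = b := fun x =>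
    lintegral_sub_left_eq_self (fun y => g y ^ (6 / 5 : ℝ)) x
  have hgx : ∀ x : E3, Measurable fun y => g (x - y) := fun x =>
    hg.comp (measurable_const.sub measurable_id)
  have hpt : ∀ x : E3, (∫⁻ y, g (x - y) * f y) ^ (2 : ℝ) ≤
      (∫⁻ y, g (x - y) ^ (6 / 5 : ℝ) * f y ^ (3 / 2 : ℝ)) * (a ^ (1 / 3 : ℝ) * b ^ (2 / 3 : ℝ)) := by
    intro x
    -- Three-factor Hölder with weights `1/2 + 1/6 + 1/3 = 1`, applied to `g f = (g^{6/5}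
    -- f^{3/2})^{1/2} (f^{3/2})^{1/6} (g^{6/5})^{1/3}`. Only the first factor still depends on `x`
    -- after integration in `y`.
    have hH := ENNReal.lintegral_prod_norm_pow_le (μ := (volume : Measure E3)) Finset.univ
      (f := ![fun y => g (x - y) ^ (6 / 5 : ℝ) * f y ^ (3 / 2 : ℝ), fun y => f y ^ (3 / 2 : ℝ),
        fun y => g (x - y) ^ (6 / 5 : ℝ)]) (p := ![1 / 2, 1 / 6, 1 / 3])
      (by
        intro i _
        fin_cases i
        · exact ((hgx x).pow_const _).aemeasurable.mul (hf.pow_const _)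
        · exact hf.pow_const _
        · exact ((hgx x).pow_const _).aemeasurable)
      (by simp [Fin.sum_univ_three]; norm_num)
      (by
        intro i _
        fin_cases i <;> simp)
    simp only [Fin.prod_univ_three, Matrix.cons_val_zero, Matrix.cons_val_one,
      Matrix.cons_val] at hH
    rw [htrans] at hH
    have hL : ∀ y, (g (x - y) ^ (6 / 5 : ℝ) * f y ^ (3 / 2 : ℝ)) ^ (1 / 2 : ℝ) *
        (f y ^ (3 / 2 : ℝ)) ^ (1 / 6 : ℝ) * (g (x - y) ^ (6 / 5 : ℝ)) ^ (1 / 3 : ℝ) =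
        g (x - y) * f y := fun y => by
      rw [ENNReal.mul_rpow_of_nonneg _ _ (by norm_num), ← ENNReal.rpow_mul, ← ENNReal.rpow_mul,
        ← ENNReal.rpow_mul, ← ENNReal.rpow_mul]
      calc _ = (g (x - y) ^ (6 / 5 * (1 / 2) : ℝ) * g (x - y) ^ (6 / 5 * (1 / 3) : ℝ)) *
            (f y ^ (3 / 2 * (1 / 2) : ℝ) * f y ^ (3 / 2 * (1 / 6) : ℝ)) := by ring
        _ = _ := by
          rw [← ENNReal.rpow_add_of_nonneg _ _ (by norm_num) (by norm_num),
            ← ENNReal.rpow_add_of_nonneg _ _ (by norm_num) (by norm_num)]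
          norm_num
    simp_rw [hL] at hH
    calc _ ≤ ((∫⁻ y, g (x - y) ^ (6 / 5 : ℝ) * f y ^ (3 / 2 : ℝ)) ^ (1 / 2 : ℝ) *
          a ^ (1 / 6 : ℝ) * b ^ (1 / 3 : ℝ)) ^ (2 : ℝ) := by gcongr
      _ = _ := by
        rw [ENNReal.mul_rpow_of_nonneg _ _ (by norm_num),
          ENNReal.mul_rpow_of_nonneg _ _ (by norm_num), ← ENNReal.rpow_mul, ← ENNReal.rpow_mul,
          ← ENNReal.rpow_mul]
        norm_num [mul_assoc]
  have hmeas : AEMeasurable (fun p : E3 × E3 => g (p.1 - p.2) ^ (6 / 5 : ℝ) *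
      f p.2 ^ (3 / 2 : ℝ)) (volume.prod volume) :=
    ((hg.comp (measurable_fst.sub measurable_snd)).pow_const _).aemeasurable.mul
      (hf.comp_snd.pow_const _)
  calc _ ≤ ∫⁻ x, (∫⁻ y, g (x - y) ^ (6 / 5 : ℝ) * f y ^ (3 / 2 : ℝ)) *
        (a ^ (1 / 3 : ℝ) * b ^ (2 / 3 : ℝ)) := lintegral_mono hpt
    _ = (∫⁻ x, ∫⁻ y, g (x - y) ^ (6 / 5 : ℝ) * f y ^ (3 / 2 : ℝ)) *
        (a ^ (1 / 3 : ℝ) * b ^ (2 / 3 : ℝ)) := by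
      rw [lintegral_mul_const'' _ hmeas.lintegral_prod_right']
    _ = (b * a) * (a ^ (1 / 3 : ℝ) * b ^ (2 / 3 : ℝ)) := by
      congr 1
      rw [lintegral_lintegral_swap hmeas]
      have : ∀ y : E3, ∫⁻ x, g (x - y) ^ (6 / 5 : ℝ) * f y ^ (3 / 2 : ℝ) =
          b * f y ^ (3 / 2 : ℝ) := fun y => by
        have hm : Measurable fun x => g (x - y) ^ (6 / 5 : ℝ) :=
          (hg.comp (measurable_id.sub measurable_const)).pow_const _
        rw [lintegral_mul_const _ hm,
          lintegral_sub_right_eq_self (fun y => g y ^ (6 / 5 : ℝ)) y]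
      simp_rw [this]
      rw [lintegral_const_mul'' _ (hf.pow_const _)]
    _ = (a ^ (1 : ℝ) * a ^ (1 / 3 : ℝ)) * (b ^ (1 : ℝ) * b ^ (2 / 3 : ℝ)) := by
      simp only [ENNReal.rpow_one]; ring
    _ = _ := by
      rw [← ENNReal.rpow_add_of_nonneg _ _ (by norm_num) (by norm_num),
        ← ENNReal.rpow_add_of_nonneg _ _ (by norm_num) (by norm_num)]
      norm_num

/-- Hölder's inequality for the exponents `3` and `3/2`, in the form of a pointwise bound for a
convolution. -/
theorem lintegral_convolution_le {f g : E3 → ℝ≥0∞} (hf : AEMeasurable f) (hg : Measurable g)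
    (x : E3) :
    ∫⁻ y, g (x - y) * f y ≤
      (∫⁻ y, g y ^ (3 : ℝ)) ^ (1 / 3 : ℝ) * (∫⁻ y, f y ^ (3 / 2 : ℝ)) ^ (2 / 3 : ℝ) := by
  have hgx : Measurable fun y => g (x - y) := hg.comp (measurable_const.sub measurable_id)
  have := ENNReal.lintegral_mul_le_Lp_mul_Lq (volume : Measure E3)
    (p := 3) (q := 3 / 2) (Real.holderConjugate_iff.2 ⟨by norm_num, by norm_num⟩)
    hgx.aemeasurable hf
  rw [lintegral_sub_left_eq_self (fun y => g y ^ (3 : ℝ)) x] at this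
  simpa using this

/-! ### Newton potentials of `L^{3/2}` functions. -/

/-- The convolution of `f` with the `j`-th component of the gradient of the Newton kernel. -/
noncomputable def newtonPot (j : Fin 3) (f : E3 → ℝ) (x : E3) : ℝ :=
  ∫ y, newtonKernel j (x - y) * f y

/-- The convolution of the absolute values of the kernel and of `f`. -/
noncomputable def absPot (j : Fin 3) (f : E3 → ℝ) (x : E3) : ℝ≥0∞ :=
  ∫⁻ y, ‖newtonKernel j (x - y)‖ₑ * ‖f y‖ₑ

/-- The part of the kernel inside the ball of radius `r`. -/
noncomputable def nearKernel (j : Fin 3) (r : ℝ) : E3 → ℝ :=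
  (Metric.ball 0 r).indicator (newtonKernel j)

/-- The part of the kernel outside the ball of radius `r`. -/
noncomputable def farKernel (j : Fin 3) (r : ℝ) : E3 → ℝ :=
  (Metric.ball 0 r)ᶜ.indicator (newtonKernel j)

theorem measurable_nearKernel (j : Fin 3) (r : ℝ) : Measurable (nearKernel j r) :=
  (measurable_newtonKernel j).indicator measurableSet_ball

theorem measurable_farKernel (j : Fin 3) (r : ℝ) : Measurable (farKernel j r) :=
  (measurable_newtonKernel j).indicator measurableSet_ball.compl

theorem nearKernel_add_farKernel (j : Fin 3) (r : ℝ) (z : E3) :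
    nearKernel j r z + farKernel j r z = newtonKernel j z :=
  congrFun (Set.indicator_self_add_compl _ _) z

theorem lintegral_nearKernel (j : Fin 3) (r : ℝ) :
    ∫⁻ z, ‖nearKernel j r z‖ₑ ^ (6 / 5 : ℝ) =
      ∫⁻ z in Metric.ball 0 r, ‖newtonKernel j z‖ₑ ^ (6 / 5 : ℝ) := by
  rw [← lintegral_indicator measurableSet_ball]
  refine lintegral_congr fun z => ?_
  by_cases h : z ∈ Metric.ball (0 : E3) r <;> simp only [nearKernel, Set.indicator, h] <;> simp

theorem lintegral_farKernel (j : Fin 3) (r : ℝ) :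
    ∫⁻ z, ‖farKernel j r z‖ₑ ^ (3 : ℝ) =
      ∫⁻ z in (Metric.ball 0 r)ᶜ, ‖newtonKernel j z‖ₑ ^ (3 : ℝ) := by
  rw [← lintegral_indicator measurableSet_ball.compl]
  refine lintegral_congr fun z => ?_
  by_cases h : z ∈ (Metric.ball (0 : E3) r)ᶜ <;> simp only [farKernel, Set.indicator, h] <;> simp

theorem lintegral_farKernel_lt_top (j : Fin 3) {r : ℝ} (hr : 0 < r) :
    ∫⁻ z, ‖farKernel j r z‖ₑ ^ (3 : ℝ) < ⊤ := by
  rw [lintegral_farKernel]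
  exact lintegral_compl_ball_newtonKernel_lt_top j hr

theorem enorm_newtonPot_le_absPot (j : Fin 3) (f : E3 → ℝ) (x : E3) :
    ‖newtonPot j f x‖ₑ ≤ absPot j f x :=
  (enorm_integral_le_lintegral_enorm _).trans_eq (lintegral_congr fun _ => enorm_mul _ _)

theorem aestronglyMeasurable_convolution_integrand {k f : E3 → ℝ} (hk : Measurable k)
    (hf : AEStronglyMeasurable f) :
    AEStronglyMeasurable (fun p : E3 × E3 => k (p.1 - p.2) * f p.2) (volume.prod volume) :=
  (hk.comp (measurable_fst.sub measurable_snd)).aestronglyMeasurable.mul hf.comp_snd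

theorem aestronglyMeasurable_newtonPot (j : Fin 3) {f : E3 → ℝ} (hf : AEStronglyMeasurable f) :
    AEStronglyMeasurable (newtonPot j f) :=
  (aestronglyMeasurable_convolution_integrand (measurable_newtonKernel j) hf).integral_prod_right'

theorem absPot_le_near_add_far (j : Fin 3) {f : E3 → ℝ} (hf : AEStronglyMeasurable f) (r : ℝ)
    (x : E3) :
    absPot j f x ≤ (∫⁻ y, ‖nearKernel j r (x - y)‖ₑ * ‖f y‖ₑ) +
      ∫⁻ y, ‖farKernel j r (x - y)‖ₑ * ‖f y‖ₑ := by
  have hm : AEMeasurable fun y => ‖nearKernel j r (x - y)‖ₑ * ‖f y‖ₑ :=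
    ((measurable_nearKernel j r).comp
      (measurable_const.sub measurable_id)).enorm.aemeasurable.mul hf.enorm
  rw [← lintegral_add_left' hm]
  refine lintegral_mono fun y => ?_
  rw [← add_mul, ← nearKernel_add_farKernel j r]
  gcongr
  exact enorm_add_le _ _

theorem add_sq_le_two_mul (a b : ℝ≥0∞) :
    (a + b) ^ (2 : ℝ) ≤ 2 * (a ^ (2 : ℝ) + b ^ (2 : ℝ)) := by
  have := ENNReal.rpow_add_le_mul_rpow_add_rpow a b (p := 2) (by norm_num)
  norm_num at this ⊢
  exact this

theorem lintegral_farKernel_le (j : Fin 3) {f : E3 → ℝ} (hf : AEStronglyMeasurable f) (r : ℝ)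
    (x : E3) :
    ∫⁻ y, ‖farKernel j r (x - y)‖ₑ * ‖f y‖ₑ ≤
      (∫⁻ y, ‖farKernel j r y‖ₑ ^ (3 : ℝ)) ^ (1 / 3 : ℝ) *
        (∫⁻ y, ‖f y‖ₑ ^ (3 / 2 : ℝ)) ^ (2 / 3 : ℝ) :=
  lintegral_convolution_le (g := fun y => ‖farKernel j r y‖ₑ) hf.enorm
    (measurable_farKernel j r).enorm x

/-- The near part is square integrable on the whole space by Young, and the far part is bounded by
Hölder. The finite measure of `S` is needed only for the bounded part. -/
theorem setLIntegral_absPot_sq_lt_top (j : Fin 3) {f : E3 → ℝ} (hf : AEStronglyMeasurable f)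
    (hf' : ∫⁻ y, ‖f y‖ₑ ^ (3 / 2 : ℝ) < ⊤) {S : Set E3} (hS : volume S < ⊤) :
    ∫⁻ x in S, absPot j f x ^ (2 : ℝ) < ⊤ := by
  set N := fun x => ∫⁻ y, ‖nearKernel j 1 (x - y)‖ₑ * ‖f y‖ₑ
  set c := (∫⁻ y, ‖farKernel j 1 y‖ₑ ^ (3 : ℝ)) ^ (1 / 3 : ℝ) *
        (∫⁻ y, ‖f y‖ₑ ^ (3 / 2 : ℝ)) ^ (2 / 3 : ℝ)
  have hc : c < ⊤ := ENNReal.mul_lt_top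
    (ENNReal.rpow_lt_top_of_nonneg (by norm_num) (lintegral_farKernel_lt_top j one_pos).ne)
    (ENNReal.rpow_lt_top_of_nonneg (by norm_num) hf'.ne)
  have hN : ∫⁻ x, N x ^ (2 : ℝ) < ⊤ := by
    refine (lintegral_sq_convolution_le (g := fun y => ‖nearKernel j 1 y‖ₑ) hf.enorm
      (measurable_nearKernel j 1).enorm).trans_lt (ENNReal.mul_lt_top
      (ENNReal.rpow_lt_top_of_nonneg (by norm_num) hf'.ne)
      (ENNReal.rpow_lt_top_of_nonneg (by norm_num) ?_))
    rw [lintegral_nearKernel]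
    exact (lintegral_ball_newtonKernel_lt_top j one_pos).ne
  calc ∫⁻ x in S, absPot j f x ^ (2 : ℝ) ≤ ∫⁻ x in S, 2 * (N x ^ (2 : ℝ) + c ^ (2 : ℝ)) := by
        refine lintegral_mono fun x => ?_
        refine le_trans ?_ (add_sq_le_two_mul _ _)
        gcongr
        refine (absPot_le_near_add_far j hf 1 x).trans ?_
        gcongr
        exact lintegral_farKernel_le j hf 1 x
    _ = 2 * ((∫⁻ x in S, N x ^ (2 : ℝ)) + c ^ (2 : ℝ) * volume S) := by
        rw [lintegral_const_mul' _ _ (by norm_num), lintegral_add_right _ measurable_const,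
          setLIntegral_const]
    _ < ⊤ := by
        refine ENNReal.mul_lt_top (by norm_num) (ENNReal.add_lt_top.2
          ⟨(setLIntegral_le_lintegral _ _).trans_lt hN, ENNReal.mul_lt_top
            (ENNReal.rpow_lt_top_of_nonneg (by norm_num) hc.ne) hS⟩)

theorem memLp_newtonPot (j : Fin 3) {f : E3 → ℝ} (hf : AEStronglyMeasurable f)
    (hf' : ∫⁻ y, ‖f y‖ₑ ^ (3 / 2 : ℝ) < ⊤) {S : Set E3} (hS : volume S < ⊤) :
    MemLp (newtonPot j f) 2 (volume.restrict S) := by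
  refine ⟨(aestronglyMeasurable_newtonPot j hf).restrict, ?_⟩
  rw [eLpNorm_lt_top_iff_lintegral_rpow_enorm_lt_top (by norm_num) (by norm_num)]
  refine lt_of_le_of_lt (lintegral_mono fun x => ?_) (setLIntegral_absPot_sq_lt_top j hf hf' hS)
  simp only [ENNReal.toReal_ofNat]
  gcongr
  exact enorm_newtonPot_le_absPot j f x

/-- This is the integrability behind every use of Fubini on a potential paired with a compactly
supported function. -/
theorem integrable_newtonKernel_mul_mul (j : Fin 3) {f g : E3 → ℝ} (hf : AEStronglyMeasurable f)
    (hf' : ∫⁻ y, ‖f y‖ₑ ^ (3 / 2 : ℝ) < ⊤) (hg : Continuous g) (hg' : HasCompactSupport g) :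
    Integrable (fun p : E3 × E3 => newtonKernel j (p.1 - p.2) * f p.2 * g p.1)
      (volume.prod volume) := by
  have hm : AEStronglyMeasurable (fun p : E3 × E3 => newtonKernel j (p.1 - p.2) * f p.2 * g p.1)
      (volume.prod volume) :=
    (aestronglyMeasurable_convolution_integrand (measurable_newtonKernel j) hf).mul
      (hg.comp continuous_fst).aestronglyMeasurable
  refine ⟨hm, ?_⟩
  rw [hasFiniteIntegral_iff_enorm, lintegral_prod _ hm.enorm]
  obtain ⟨M, hM⟩ := hg.bounded_above_of_compact_support hg'
  set S := tsupport g
  have hS : volume S < ⊤ := hg'.isCompact.measure_lt_top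
  have hSm : MeasurableSet S := (isClosed_tsupport g).measurableSet
  -- The inequality `t ≤ 1 + t²` reduces the first power of `absPot` to the square, already known to
  -- be integrable on the support.
  have hbound : ∀ x, ∫⁻ y, ‖newtonKernel j (x - y) * f y * g x‖ₑ ≤
      S.indicator (fun x => ENNReal.ofReal M * (1 + absPot j f x ^ (2 : ℝ))) x := by
    intro x
    by_cases hx : x ∈ S
    · rw [Set.indicator_of_mem hx]
      simp_rw [enorm_mul]
      rw [lintegral_mul_const' _ _ enorm_ne_top, mul_comm]
      gcongr
      · rw [← ofReal_norm]
        exact ENNReal.ofReal_le_ofReal (hM x)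
      · change absPot j f x ≤ _
        rcases le_total (absPot j f x) 1 with h | h
        · exact h.trans le_self_add
        · refine le_trans ?_ le_add_self
          conv_lhs => rw [← ENNReal.rpow_one (absPot j f x)]
          exact ENNReal.rpow_le_rpow_of_exponent_le h (by norm_num)
    · simp [image_eq_zero_of_notMem_tsupport hx]
  refine (lintegral_mono hbound).trans_lt ?_
  rw [lintegral_indicator hSm, lintegral_const_mul' _ _ ENNReal.ofReal_ne_top,
    lintegral_add_left measurable_const]
  refine ENNReal.mul_lt_top ENNReal.ofReal_lt_top (ENNReal.add_lt_top.2 ⟨?_,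
    setLIntegral_absPot_sq_lt_top j hf hf' hS⟩)
  simpa using hS

theorem newtonPot_eq_neg (j : Fin 3) (g : E3 → ℝ) (y : E3) :
    newtonPot j g y = -∫ x, newtonKernel j (x - y) * g x := by
  rw [newtonPot, ← integral_neg]
  congr 1 with x
  rw [← neg_sub, newtonKernel_neg, neg_mul]

theorem integrable_newtonPot_mul (j : Fin 3) {f g : E3 → ℝ} (hf : AEStronglyMeasurable f)
    (hf' : ∫⁻ y, ‖f y‖ₑ ^ (3 / 2 : ℝ) < ⊤) (hg : Continuous g) (hg' : HasCompactSupport g) :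
    Integrable fun x => newtonPot j f x * g x := by
  refine (integrable_newtonKernel_mul_mul j hf hf' hg hg').integral_prod_left.congr
    (Eventually.of_forall fun x => ?_)
  exact integral_mul_const (g x) fun y => newtonKernel j (x - y) * f y

theorem integrable_mul_newtonPot (j : Fin 3) {f g : E3 → ℝ} (hf : AEStronglyMeasurable f)
    (hf' : ∫⁻ y, ‖f y‖ₑ ^ (3 / 2 : ℝ) < ⊤) (hg : Continuous g) (hg' : HasCompactSupport g) :
    Integrable fun x => f x * newtonPot j g x := by
  refine (integrable_newtonKernel_mul_mul j hf hf' hg hg').integral_prod_right.neg.congr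
    (Eventually.of_forall fun y => ?_)
  simp only [Pi.neg_apply]
  rw [newtonPot_eq_neg, mul_neg, ← integral_const_mul]
  congr 2 with x
  ring

/-- The operators `newtonPot j` are antisymmetric. -/
theorem integral_newtonPot_mul (j : Fin 3) {f g : E3 → ℝ} (hf : AEStronglyMeasurable f)
    (hf' : ∫⁻ y, ‖f y‖ₑ ^ (3 / 2 : ℝ) < ⊤) (hg : Continuous g) (hg' : HasCompactSupport g) :
    ∫ x, newtonPot j f x * g x = -∫ x, f x * newtonPot j g x := by
  calc ∫ x, newtonPot j f x * g x
      = ∫ x, ∫ y, newtonKernel j (x - y) * f y * g x := by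
        congr 1 with x
        exact (integral_mul_const _ _).symm
    _ = ∫ y, ∫ x, newtonKernel j (x - y) * f y * g x :=
        integral_integral_swap (integrable_newtonKernel_mul_mul j hf hf' hg hg')
    _ = ∫ y, -(f y * newtonPot j g y) := by
        congr 1 with y
        rw [newtonPot_eq_neg, mul_neg, neg_neg, ← integral_const_mul]
        congr 1 with x
        ring
    _ = _ := integral_neg _

theorem integrable_farKernel_mul (j : Fin 3) {f : E3 → ℝ} (hf : AEStronglyMeasurable f)
    (hf' : ∫⁻ y, ‖f y‖ₑ ^ (3 / 2 : ℝ) < ⊤) {r : ℝ} (hr : 0 < r) (x : E3) :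
    Integrable fun y => farKernel j r (x - y) * f y := by
  refine ⟨((measurable_farKernel j r).comp
    (measurable_const.sub measurable_id)).aestronglyMeasurable.mul hf, ?_⟩
  rw [hasFiniteIntegral_iff_enorm]
  simp_rw [enorm_mul]
  exact (lintegral_farKernel_le j hf r x).trans_lt (ENNReal.mul_lt_top
    (ENNReal.rpow_lt_top_of_nonneg (by norm_num) (lintegral_farKernel_lt_top j hr).ne)
    (ENNReal.rpow_lt_top_of_nonneg (by norm_num) hf'.ne))

/-- The absolute value stays outside the far integral: weak convergence says nothing about integrals
of absolute values. -/
theorem enorm_newtonPot_le_near_add_far (j : Fin 3) {f : E3 → ℝ} (hf : AEStronglyMeasurable f)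
    (hf' : ∫⁻ y, ‖f y‖ₑ ^ (3 / 2 : ℝ) < ⊤) {r : ℝ} (hr : 0 < r) (x : E3) :
    ‖newtonPot j f x‖ₑ ≤ (∫⁻ y, ‖nearKernel j r (x - y)‖ₑ * ‖f y‖ₑ) +
      ‖∫ y, farKernel j r (x - y) * f y‖ₑ := by
  have hfar := integrable_farKernel_mul j hf hf' hr x
  have hsplit : ∀ y, newtonKernel j (x - y) * f y =
      nearKernel j r (x - y) * f y + farKernel j r (x - y) * f y := fun y => by
    rw [← add_mul, nearKernel_add_farKernel]
  by_cases hnear : Integrable fun y => nearKernel j r (x - y) * f y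
  · rw [newtonPot]
    simp_rw [hsplit]
    rw [integral_add hnear hfar]
    refine (enorm_add_le _ _).trans ?_
    gcongr
    exact (enorm_integral_le_lintegral_enorm _).trans_eq (lintegral_congr fun _ => enorm_mul _ _)
  -- The far integrand is always integrable, so a non-integrable near part makes the full integrand
  -- non-integrable, and the Bochner integral is then `0` by convention.
  · have : newtonPot j f x = 0 := by
      refine integral_undef fun h => hnear ?_
      refine (h.sub hfar).congr (Eventually.of_forall fun y => ?_)
      simp [hsplit]
    simp [this]

/-! ### From weak to strong convergence. -/

/-- The Newton potentials of a bounded sequence of `L^{3/2}` whose pairings with the truncated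
kernels tend to zero converge to zero in `L²` on sets of finite measure. -/
theorem tendsto_setLIntegral_newtonPot (j : Fin 3) {h : ℕ → E3 → ℝ}
    (hm : ∀ n, AEStronglyMeasurable (h n)) {M : ℝ≥0∞} (hM : M < ⊤)
    (hb : ∀ n, ∫⁻ y, ‖h n y‖ₑ ^ (3 / 2 : ℝ) ≤ M)
    (hweak : ∀ r : ℝ, 0 < r → ∀ x, Tendsto (fun n => ∫ y, farKernel j r (x - y) * h n y)
      atTop (𝓝 0)) {S : Set E3} (hS : volume S < ⊤) :
    Tendsto (fun n => ∫⁻ x in S, ‖newtonPot j (h n) x‖ₑ ^ (2 : ℝ)) atTop (𝓝 0) := by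
  have hfin : ∀ n, ∫⁻ y, ‖h n y‖ₑ ^ (3 / 2 : ℝ) < ⊤ := fun n => (hb n).trans_lt hM
  have hM' : M ^ (4 / 3 : ℝ) ≠ ⊤ := (ENNReal.rpow_lt_top_of_nonneg (by norm_num) hM.ne).ne
  set c : ℕ → ℝ≥0∞ := fun k => ∫⁻ z in Metric.ball 0 (1 / ((k : ℝ) + 1)),
    ‖newtonKernel j z‖ₑ ^ (6 / 5 : ℝ) with hc
  have hsmall : Tendsto (fun k => 2 * (M ^ (4 / 3 : ℝ) * c k ^ (5 / 3 : ℝ))) atTop (𝓝 0) := by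
    have h1 : Tendsto (fun k => c k ^ (5 / 3 : ℝ)) atTop (𝓝 0) := by
      have := (tendsto_lintegral_ball_newtonKernel j).ennrpow_const (5 / 3 : ℝ)
      rwa [ENNReal.zero_rpow_of_pos (by norm_num)] at this
    have h2 := ENNReal.Tendsto.const_mul (a := 2)
      (ENNReal.Tendsto.const_mul (a := M ^ (4 / 3 : ℝ)) h1 (Or.inr hM')) (Or.inr (by norm_num))
    simpa using h2
  rw [ENNReal.tendsto_nhds_zero]
  intro ε hε
  -- The radius is fixed before `n`: the common bound `M` makes the near part at most `ε / 2` for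
  -- all `n` at once.
  obtain ⟨k, hk⟩ := ((ENNReal.tendsto_nhds_zero.1 hsmall) (ε / 2) (ENNReal.half_pos hε.ne')).exists
  set r : ℝ := 1 / ((k : ℝ) + 1) with hr'
  have hr : 0 < r := by positivity
  set far : ℕ → E3 → ℝ := fun n x => ∫ y, farKernel j r (x - y) * h n y with hfar
  have hfarm : ∀ n, AEStronglyMeasurable (far n) := fun n =>
    (aestronglyMeasurable_convolution_integrand (measurable_farKernel j r)
      (hm n)).integral_prod_right'
  set K := (∫⁻ y, ‖farKernel j r y‖ₑ ^ (3 : ℝ)) ^ (1 / 3 : ℝ) * M ^ (2 / 3 : ℝ)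
  have hK : K < ⊤ := ENNReal.mul_lt_top
    (ENNReal.rpow_lt_top_of_nonneg (by norm_num) (lintegral_farKernel_lt_top j hr).ne)
    (ENNReal.rpow_lt_top_of_nonneg (by norm_num) hM.ne)
  have hfarle : ∀ n x, ‖far n x‖ₑ ≤ K := fun n x => by
    refine (enorm_integral_le_lintegral_enorm _).trans ?_
    simp_rw [enorm_mul]
    exact (lintegral_farKernel_le j (hm n) r x).trans
      (mul_le_mul' le_rfl (ENNReal.rpow_le_rpow (hb n) (by norm_num)))
  -- The constant `K ^ 2` dominates, and is integrable because `S` has finite measure.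
  have hfarlim : Tendsto (fun n => 2 * ∫⁻ x in S, ‖far n x‖ₑ ^ (2 : ℝ)) atTop (𝓝 0) := by
    have h1 : Tendsto (fun n => ∫⁻ x in S, ‖far n x‖ₑ ^ (2 : ℝ)) atTop
        (𝓝 (∫⁻ _ in S, 0)) := by
      refine tendsto_lintegral_of_dominated_convergence' (fun _ => K ^ (2 : ℝ))
        (fun n => ((hfarm n).enorm.pow_const _).restrict)
        (fun n => Eventually.of_forall fun x => ?_) ?_ (Eventually.of_forall fun x => ?_)
      · dsimp only
        gcongr
        exact hfarle n x
      · rw [setLIntegral_const]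
        exact (ENNReal.mul_lt_top (ENNReal.rpow_lt_top_of_nonneg (by norm_num) hK.ne) hS).ne
      · have h2 : Tendsto (fun n => ‖far n x‖ₑ) atTop (𝓝 0) := by
          have := (hweak r hr x).enorm
          simpa using this
        have := h2.ennrpow_const (2 : ℝ)
        simpa using this
    have h3 := ENNReal.Tendsto.const_mul (a := 2) h1 (Or.inr (by norm_num))
    simpa using h3
  filter_upwards [(ENNReal.tendsto_nhds_zero.1 hfarlim) (ε / 2) (ENNReal.half_pos hε.ne')] with n hn
  calc ∫⁻ x in S, ‖newtonPot j (h n) x‖ₑ ^ (2 : ℝ)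
      ≤ ∫⁻ x in S, 2 * ((∫⁻ y, ‖nearKernel j r (x - y)‖ₑ * ‖h n y‖ₑ) ^ (2 : ℝ) +
          ‖far n x‖ₑ ^ (2 : ℝ)) := by
        refine lintegral_mono fun x => ?_
        refine le_trans ?_ (add_sq_le_two_mul _ _)
        gcongr
        exact enorm_newtonPot_le_near_add_far j (hm n) (hfin n) hr x
    _ = 2 * (∫⁻ x in S, (∫⁻ y, ‖nearKernel j r (x - y)‖ₑ * ‖h n y‖ₑ) ^ (2 : ℝ)) +
          2 * ∫⁻ x in S, ‖far n x‖ₑ ^ (2 : ℝ) := by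
        rw [lintegral_const_mul' _ _ (by norm_num),
          lintegral_add_right' _ ((hfarm n).enorm.pow_const _).restrict, mul_add]
    _ ≤ ε / 2 + ε / 2 := by
        gcongr
        refine le_trans ?_ hk
        gcongr
        refine (setLIntegral_le_lintegral _ _).trans ?_
        refine (lintegral_sq_convolution_le (g := fun y => ‖nearKernel j r y‖ₑ) (hm n).enorm
          (measurable_nearKernel j r).enorm).trans ?_
        rw [lintegral_nearKernel]
        gcongr
        exact hb n
    _ = ε := ENNReal.add_halves ε

/-! ### Potentials of test functions and the fundamental solution. -/

theorem continuous_partialDeriv (i : Fin 3) {g : E3 → ℝ} (hg : ContDiff ℝ ∞ g) :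
    Continuous (partialDeriv i g) :=
  (hg.continuous_fderiv (by simp)).clm_apply continuous_const

theorem contDiff_partialDeriv (i : Fin 3) {g : E3 → ℝ} (hg : ContDiff ℝ ∞ g) :
    ContDiff ℝ ∞ (partialDeriv i g) :=
  (hg.fderiv_right (m := ∞) (by simp)).clm_apply contDiff_const

theorem hasCompactSupport_partialDeriv (i : Fin 3) {g : E3 → ℝ} (hg : HasCompactSupport g) :
    HasCompactSupport (partialDeriv i g) :=
  hg.fderiv_apply (𝕜 := ℝ) _

theorem newtonPot_eq_convolution (j : Fin 3) (g : E3 → ℝ) :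
    newtonPot j g = convolution (newtonKernel j) g (ContinuousLinearMap.mul ℝ ℝ) volume := by
  ext x
  rw [convolution_eq_swap]
  rfl

theorem newtonPot_eq_integral (j : Fin 3) (g : E3 → ℝ) (x : E3) :
    newtonPot j g x = ∫ t, newtonKernel j t * g (x - t) := by
  rw [newtonPot_eq_convolution]
  rfl

theorem contDiff_newtonPot (j : Fin 3) {g : E3 → ℝ} (hg : ContDiff ℝ ∞ g)
    (hg' : HasCompactSupport g) : ContDiff ℝ ∞ (newtonPot j g) := by
  rw [newtonPot_eq_convolution]
  exact hg'.contDiff_convolution_right _ (locallyIntegrable_newtonKernel j) hg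

theorem partialDeriv_newtonPot (i j : Fin 3) {g : E3 → ℝ} (hg : ContDiff ℝ ∞ g)
    (hg' : HasCompactSupport g) (x : E3) :
    partialDeriv i (newtonPot j g) x = newtonPot j (partialDeriv i g) x := by
  rw [newtonPot_eq_convolution, newtonPot_eq_convolution, partialDeriv,
    (hg'.hasFDerivAt_convolution_right (ContinuousLinearMap.mul ℝ ℝ)
      (locallyIntegrable_newtonKernel j) (hg.of_le (by simp)) x).fderiv,
    convolution_precompR_apply _ (locallyIntegrable_newtonKernel j) (hg'.fderiv ℝ)
      (hg.continuous_fderiv (by simp))]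
  rfl

theorem fderiv_apply_eq_sum_partialDeriv (g : E3 → ℝ) (x v : E3) :
    fderiv ℝ g x v = ∑ i, v i * partialDeriv i g x := by
  conv_lhs => rw [← (EuclideanSpace.basisFun (Fin 3) ℝ).sum_repr v]
  simp [partialDeriv]

/-- Integration in polar coordinates. -/
theorem integral_eq_integral_sphere_integral_Ioi {F : E3 → ℝ} (hF : Integrable F) :
    ∫ x, F x = ∫ u : Metric.sphere (0 : E3) 1,
      (∫ r in Set.Ioi (0 : ℝ), r ^ 2 * F (r • (u : E3))) ∂(volume : Measure E3).toSphere := by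
  have hmp := (volume : Measure E3).measurePreserving_homeomorphUnitSphereProd
  have hemb := (homeomorphUnitSphereProd E3).measurableEmbedding
  set G : Metric.sphere (0 : E3) 1 × Set.Ioi (0 : ℝ) → ℝ :=
    fun p => F ((p.2 : ℝ) • (p.1 : E3)) with hG
  have hGF : ∀ x : ({(0 : E3)}ᶜ : Set E3), G (homeomorphUnitSphereProd E3 x) = F x := fun x => by
    simp only [hG, homeomorphUnitSphereProd_apply_fst_coe, homeomorphUnitSphereProd_apply_snd_coe]
    rw [smul_inv_smul₀ (norm_ne_zero_iff.2 x.2)]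
  have hGint : Integrable G ((volume : Measure E3).toSphere.prod (.volumeIoiPow 2)) := by
    have h := (hmp.integrable_comp_emb hemb (g := G)).1
    simp only [finrank_euclideanSpace, Fintype.card_fin] at h
    refine h ?_
    have : G ∘ homeomorphUnitSphereProd E3 = F ∘ Subtype.val := funext hGF
    rw [this, ← integrableOn_iff_comap_subtypeVal (measurableSet_singleton _).compl]
    exact hF.integrableOn
  calc ∫ x, F x = ∫ x : ({(0)}ᶜ : Set E3), F x ∂(Measure.comap Subtype.val volume) := by
        rw [integral_subtype_comap (measurableSet_singleton _).compl F, restrict_compl_singleton]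
    _ = ∫ p, G p ∂(volume : Measure E3).toSphere.prod (.volumeIoiPow 2) := by
        have := hmp.integral_comp hemb G
        simp only [finrank_euclideanSpace, Fintype.card_fin] at this
        rw [← this]
        exact integral_congr_ae (Eventually.of_forall fun x => (hGF x).symm)
    _ = ∫ u, ∫ r, G (u, r) ∂(.volumeIoiPow 2) ∂(volume : Measure E3).toSphere :=
        integral_prod _ hGint
    _ = _ := by
      congr 1 with u
      simp only [Measure.volumeIoiPow, ENNReal.ofReal]
      rw [integral_withDensity_eq_integral_smul
          ((measurable_subtype_coe.pow_const _).real_toNNReal),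
        integral_subtype_comap measurableSet_Ioi
          fun a : ℝ => Real.toNNReal (a ^ 2) • F (a • (u : E3))]
      refine setIntegral_congr_fun measurableSet_Ioi fun r hr => ?_
      simp only [NNReal.smul_def, smul_eq_mul]
      rw [Real.coe_toNNReal _ (by positivity)]

theorem integrable_newtonKernel_mul (j : Fin 3) {g : E3 → ℝ} (hg : Continuous g)
    (hg' : HasCompactSupport g) (x : E3) :
    Integrable fun t => newtonKernel j t * g (x - t) :=
  hg'.convolutionExists_right (ContinuousLinearMap.mul ℝ ℝ) (locallyIntegrable_newtonKernel j) hg x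

/-- Fundamental theorem of calculus along the ray leaving `x` in direction `-u`; compact support
removes the endpoint at infinity. -/
theorem integral_Ioi_fderiv_ray {g : E3 → ℝ} (hg : ContDiff ℝ ∞ g) (hg' : HasCompactSupport g)
    (x : E3) (u : Metric.sphere (0 : E3) 1) :
    ∫ r in Set.Ioi (0 : ℝ), fderiv ℝ g (x - r • (u : E3)) u = g x := by
  have hd : ∀ r : ℝ, HasDerivAt (fun r : ℝ => g (x - r • (u : E3)))
      (-fderiv ℝ g (x - r • (u : E3)) u) r := fun r => by
    have h1 : HasDerivAt (fun r : ℝ => x - r • (u : E3)) (-(u : E3)) r := by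
      simpa using ((hasDerivAt_id r).smul_const (u : E3)).const_sub x
    have h2 := ((hg.differentiable (by simp)) (x - r • (u : E3))).hasFDerivAt.comp_hasDerivAt r h1
    simpa using! h2
  have hsm : ContDiff ℝ 1 (fun r : ℝ => g (x - r • (u : E3))) :=
    (hg.of_le (by simp)).comp (contDiff_const.sub (contDiff_id.smul contDiff_const))
  have hcs : HasCompactSupport (fun r : ℝ => g (x - r • (u : E3))) := by
    obtain ⟨R, hR⟩ := hg'.isCompact.isBounded.subset_closedBall 0
    refine HasCompactSupport.intro (isCompact_Icc (a := -(R + ‖x‖)) (b := R + ‖x‖)) fun r hr => ?_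
    by_contra hne
    have h1 : ‖x - r • (u : E3)‖ ≤ R := by
      simpa using hR (subset_tsupport _ hne)
    have h2 : ‖r • (u : E3)‖ = |r| := by simp [norm_smul]
    have h3 : |r| ≤ R + ‖x‖ := by
      have := norm_sub_norm_le (r • (u : E3)) x
      rw [norm_sub_rev, h2] at this
      linarith
    exact hr (abs_le.1 h3)
  have := hcs.integral_Ioi_deriv_eq hsm 0
  simp_rw [fun r => (hd r).deriv] at this
  rw [integral_neg] at this
  simpa using this

/-- The divergence of the gradient of the Newton kernel is the Dirac mass. -/
theorem sum_newtonPot_partialDeriv {g : E3 → ℝ} (hg : ContDiff ℝ ∞ g)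
    (hg' : HasCompactSupport g) (x : E3) :
    ∑ j, newtonPot j (partialDeriv j g) x = g x := by
  set s := (volume : Measure E3).toSphere.real Set.univ with hs
  have hs0 : s ≠ 0 := by
    rw [hs, measureReal_def, ENNReal.toReal_ne_zero]
    exact ⟨by simp [Real.pi_pos], measure_ne_top _ _⟩
  have hint : ∀ j, Integrable fun t => newtonKernel j t * partialDeriv j g (x - t) := fun j =>
    integrable_newtonKernel_mul j (continuous_partialDeriv j hg)
      (hasCompactSupport_partialDeriv j hg') x
  simp_rw [newtonPot_eq_integral]
  rw [← integral_finsetSum _ fun j _ => hint j,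
    integral_eq_integral_sphere_integral_Ioi (integrable_finsetSum _ fun j _ => hint j)]
  -- The Jacobian `r²` cancels the size `r⁻²` of the kernel, leaving `s⁻¹` times the derivative of
  -- `g` along the ray. The result does not depend on `u`, and integration over the sphere cancels
  -- `s⁻¹`.
  have hinner : ∀ u : Metric.sphere (0 : E3) 1, ∫ r in Set.Ioi (0 : ℝ),
      r ^ 2 * ∑ j, newtonKernel j (r • (u : E3)) * partialDeriv j g (x - r • (u : E3)) =
      s⁻¹ * g x := fun u => by
    rw [← integral_Ioi_fderiv_ray hg hg' x u, ← integral_const_mul]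
    refine setIntegral_congr_fun measurableSet_Ioi fun r hr => ?_
    have hr : 0 < r := hr
    have hu : ‖(u : E3)‖ = 1 := by simp
    simp only [newtonKernel, ← hs]
    rw [fderiv_apply_eq_sum_partialDeriv, Finset.mul_sum, Finset.mul_sum]
    refine Finset.sum_congr rfl fun j _ => ?_
    rw [norm_smul, hu, Real.norm_of_nonneg hr.le, PiLp.smul_apply, smul_eq_mul]
    field_simp
  simp_rw [hinner]
  rw [integral_const, smul_eq_mul, ← hs]
  field_simp

/-! ### Weak curls are orthogonal to gradients. -/

theorem inner_eq_add_add (a b : E3) : inner ℝ a b = a 0 * b 0 + a 1 * b 1 + a 2 * b 2 := by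
  simp [PiLp.inner_apply, Fin.sum_univ_three, mul_comm]

theorem integral_add_add {f g h : E3 → ℝ} (hf : Integrable f) (hg : Integrable g)
    (hh : Integrable h) :
    ∫ x, (f x + g x + h x) = (∫ x, f x) + (∫ x, g x) + ∫ x, h x := by
  rw [← integral_add hf hg]
  exact integral_add (hf.add hg) hh

theorem integral_sub_sub_sub {f g f' g' : E3 → ℝ} (hf : Integrable f) (hg : Integrable g)
    (hf' : Integrable f') (hg' : Integrable g') :
    ∫ x, ((f x - g x) - (f' x - g' x)) =
      ((∫ x, f x) - ∫ x, g x) - ((∫ x, f' x) - ∫ x, g' x) := by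
  rw [← integral_sub hf hg, ← integral_sub hf' hg']
  exact integral_sub (hf.sub hg) (hf'.sub hg')

theorem contDiff_component {Φ : E3 → E3} (hΦ : ContDiff ℝ ∞ Φ) (i : Fin 3) :
    ContDiff ℝ ∞ fun y => Φ y i :=
  contDiff_euclidean.1 hΦ i

theorem hasCompactSupport_component {Φ : E3 → E3} (hΦ : HasCompactSupport Φ) (i : Fin 3) :
    HasCompactSupport fun y => Φ y i :=
  hΦ.comp_left (g := fun v : E3 => v i) rfl

theorem partialDeriv_comm (i j : Fin 3) {g : E3 → ℝ} (hg : ContDiff ℝ ∞ g) (x : E3) :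
    partialDeriv i (partialDeriv j g) x = partialDeriv j (partialDeriv i g) x := by
  have hd : DifferentiableAt ℝ (fderiv ℝ g) x :=
    ((hg.fderiv_right (m := ∞) (by simp)).differentiable (by simp)) x
  have key : ∀ a b : Fin 3, partialDeriv a (partialDeriv b g) x =
      fderiv ℝ (fderiv ℝ g) x (EuclideanSpace.single a 1) (EuclideanSpace.single b 1) :=
    fun a b => by
    have : HasFDerivAt (partialDeriv b g) ((fderiv ℝ (fderiv ℝ g) x).flip
        (EuclideanSpace.single b 1)) x := by
      simpa using! hd.hasFDerivAt.clm_apply (hasFDerivAt_const (EuclideanSpace.single b (1 : ℝ)) x)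
    rw [partialDeriv, this.fderiv]
    rfl
  rw [key, key]
  exact (hg.contDiffAt.isSymmSndFDerivAt (by
    rw [minSmoothness_of_isRCLikeNormedField]
    exact WithTop.coe_le_coe.2 le_top)).eq _ _

/-- A weak curl is weakly divergence free. -/
theorem HasWeakCurl.integral_inner_grad {D C : E3 → E3} (h : HasWeakCurl D C) {g : E3 → ℝ}
    (hg : ContDiff ℝ ∞ g) (hg' : HasCompactSupport g) :
    ∫ x, (C x 0 * partialDeriv 0 g x + C x 1 * partialDeriv 1 g x + C x 2 * partialDeriv 2 g x)
      = 0 := by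
  -- The test field is `∇g`, whose curl vanishes by symmetry of second derivatives.
  have h1 := h (fun x => !₂[partialDeriv 0 g x, partialDeriv 1 g x, partialDeriv 2 g x])
    (contDiff_euclidean.2 fun i => by
      fin_cases i
      · exact contDiff_partialDeriv 0 hg
      · exact contDiff_partialDeriv 1 hg
      · exact contDiff_partialDeriv 2 hg)
    (by
      refine hg'.mono' (fun x hx => ?_)
      by_contra hx'
      have hz : ∀ i, partialDeriv i g x = 0 := fun i => by
        rw [partialDeriv, fderiv_of_notMem_tsupport ℝ hx']
        rfl
      refine hx ?_
      ext i
      fin_cases i <;> simp [hz])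
  have h2 : ∀ x, curl (fun x => !₂[partialDeriv 0 g x, partialDeriv 1 g x, partialDeriv 2 g x]) x
      = 0 := fun x => by
    ext i
    fin_cases i <;> simp [curl, partialDeriv_comm _ _ hg]
  simp only [h2, inner_zero_right, integral_zero] at h1
  rw [h1]
  congr 1 with x
  rw [inner_eq_add_add]
  simp

/-- A fixed smooth cutoff function, equal to `1` on the unit ball. -/
noncomputable def cutoff : ContDiffBump (0 : E3) where
  rIn := 1
  rOut := 2
  rIn_pos := one_pos
  rIn_lt_rOut := one_lt_two

/-- The rescaled cutoff functions. -/
noncomputable def cutoffSeq (n : ℕ) (x : E3) : ℝ := cutoff ((1 / ((n : ℝ) + 1)) • x)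

theorem contDiff_cutoffSeq (n : ℕ) : ContDiff ℝ ∞ (cutoffSeq n) :=
  cutoff.contDiff.comp (contDiff_id.const_smul (1 / ((n : ℝ) + 1)))

theorem hasCompactSupport_cutoffSeq (n : ℕ) : HasCompactSupport (cutoffSeq n) :=
  cutoff.hasCompactSupport.comp_smul (by positivity)

theorem norm_cutoffSeq_le (n : ℕ) (x : E3) : ‖cutoffSeq n x‖ ≤ 1 := by
  rw [cutoffSeq, Real.norm_of_nonneg cutoff.nonneg]
  exact cutoff.le_one

theorem tendsto_cutoffSeq (x : E3) : Tendsto (fun n => cutoffSeq n x) atTop (𝓝 1) := by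
  have h1 : Tendsto (fun n : ℕ => (1 / ((n : ℝ) + 1)) • x) atTop (𝓝 0) := by
    simpa using (tendsto_one_div_add_atTop_nhds_zero_nat (𝕜 := ℝ)).smul_const x
  have h2 := (cutoff.continuous.tendsto 0).comp h1
  rwa [cutoff.one_of_mem_closedBall (by simp [cutoff])] at h2

theorem partialDeriv_cutoffSeq (k : Fin 3) (n : ℕ) (x : E3) :
    partialDeriv k (cutoffSeq n) x =
      (1 / ((n : ℝ) + 1)) * partialDeriv k cutoff ((1 / ((n : ℝ) + 1)) • x) := by
  have h1 : HasFDerivAt (fun x : E3 => (1 / ((n : ℝ) + 1)) • x)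
      ((1 / ((n : ℝ) + 1)) • ContinuousLinearMap.id ℝ E3) x :=
    (hasFDerivAt_id (𝕜 := ℝ) x).const_smul (1 / ((n : ℝ) + 1))
  have h2 := ((cutoff.contDiff (n := 1)).differentiable one_ne_zero
    ((1 / ((n : ℝ) + 1)) • x)).hasFDerivAt.comp x h1
  rw [partialDeriv, show cutoffSeq n = cutoff ∘ fun x : E3 => (1 / ((n : ℝ) + 1)) • x from rfl,
    h2.fderiv]
  simp [partialDeriv]

theorem exists_norm_partialDeriv_cutoff_le (k : Fin 3) :
    ∃ M, ∀ x, ‖partialDeriv k cutoff x‖ ≤ M :=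
  (continuous_partialDeriv k cutoff.contDiff).bounded_above_of_compact_support
    (hasCompactSupport_partialDeriv k cutoff.hasCompactSupport)

theorem tendsto_integral_mul_cutoffSeq {f : E3 → ℝ} (hf : Integrable f) :
    Tendsto (fun n => ∫ x, f x * cutoffSeq n x) atTop (𝓝 (∫ x, f x)) := by
  refine tendsto_integral_of_dominated_convergence (fun x => ‖f x‖)
    (fun n => hf.aestronglyMeasurable.mul (contDiff_cutoffSeq n).continuous.aestronglyMeasurable)
    hf.norm (fun n => Eventually.of_forall fun x => ?_) (Eventually.of_forall fun x => ?_)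
  · rw [norm_mul]
    exact mul_le_of_le_one_right (norm_nonneg _) (norm_cutoffSeq_le n x)
  · simpa using (tendsto_cutoffSeq x).const_mul (f x)

/-- Rescaling puts a factor `1 / (n + 1)` in front of a bounded derivative. -/
theorem tendsto_integral_mul_partialDeriv_cutoffSeq (k : Fin 3) {f : E3 → ℝ} (hf : Integrable f) :
    Tendsto (fun n => ∫ x, f x * partialDeriv k (cutoffSeq n) x) atTop (𝓝 0) := by
  obtain ⟨M, hM⟩ := exists_norm_partialDeriv_cutoff_le k
  have hn : ∀ n : ℕ, ‖1 / ((n : ℝ) + 1)‖ ≤ 1 := fun n => by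
    rw [Real.norm_of_nonneg (by positivity), div_le_one (by positivity)]
    linarith [(Nat.cast_nonneg n : (0 : ℝ) ≤ n)]
  have hle : ∀ n x, ‖partialDeriv k (cutoffSeq n) x‖ ≤ ‖1 / ((n : ℝ) + 1)‖ * M := fun n x => by
    rw [partialDeriv_cutoffSeq, norm_mul]
    gcongr
    exact hM _
  have hM0 : 0 ≤ M := (norm_nonneg _).trans (hM 0)
  rw [show (0 : ℝ) = ∫ _ : E3, (0 : ℝ) by simp]
  refine tendsto_integral_of_dominated_convergence (fun x => ‖f x‖ * M)
    (fun n => hf.aestronglyMeasurable.mul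
      (continuous_partialDeriv k (contDiff_cutoffSeq n)).aestronglyMeasurable)
    (hf.norm.mul_const M) (fun n => Eventually.of_forall fun x => ?_)
    (Eventually.of_forall fun x => ?_)
  · rw [norm_mul]
    gcongr
    exact (hle n x).trans (mul_le_of_le_one_left hM0 (hn n))
  · have h0 : Tendsto (fun n => partialDeriv k (cutoffSeq n) x) atTop (𝓝 0) := by
      refine squeeze_zero_norm (hle · x) ?_
      simpa using (tendsto_one_div_add_atTop_nhds_zero_nat (𝕜 := ℝ)).norm.mul_const M
    simpa using h0.const_mul (f x)

/-- A weak curl is orthogonal to the gradient of every smooth function for which the pairings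
make sense. -/
theorem HasWeakCurl.integral_inner_grad_of_integrable {D C : E3 → E3} (h : HasWeakCurl D C)
    {g : E3 → ℝ} (hg : ContDiff ℝ ∞ g) (hint : ∀ k, Integrable fun x => C x k * g x)
    (hint' : ∀ k, Integrable fun x => C x k * partialDeriv k g x) :
    (∫ x, C x 0 * partialDeriv 0 g x) + (∫ x, C x 1 * partialDeriv 1 g x) +
      (∫ x, C x 2 * partialDeriv 2 g x) = 0 := by
  have hd : ∀ k n x, C x k * partialDeriv k (fun y => g y * cutoffSeq n y) x =
      C x k * partialDeriv k g x * cutoffSeq n x +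
        C x k * g x * partialDeriv k (cutoffSeq n) x := fun k n x => by
    have h1 : HasFDerivAt (fun y => g y * cutoffSeq n y) _ x :=
      (hg.differentiable (by simp) x).hasFDerivAt.mul
        ((contDiff_cutoffSeq n).differentiable (by simp) x).hasFDerivAt
    rw [partialDeriv, h1.fderiv]
    simp [partialDeriv]
    ring
  have hI1 : ∀ k n, Integrable fun x => C x k * partialDeriv k g x * cutoffSeq n x :=
    fun k n => (hint' k).mul_bdd (c := 1) (contDiff_cutoffSeq n).continuous.aestronglyMeasurable
      (Eventually.of_forall (norm_cutoffSeq_le n))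
  have hI2 : ∀ k n, Integrable fun x => C x k * g x * partialDeriv k (cutoffSeq n) x :=
    fun k n => by
    obtain ⟨M, hM⟩ := (continuous_partialDeriv k
      (contDiff_cutoffSeq n)).bounded_above_of_compact_support
        (hasCompactSupport_partialDeriv k (hasCompactSupport_cutoffSeq n))
    exact (hint k).mul_bdd (c := M)
      (continuous_partialDeriv k (contDiff_cutoffSeq n)).aestronglyMeasurable
      (Eventually.of_forall hM)
  have hlim : ∀ k, Tendsto (fun n => ∫ x, C x k * partialDeriv k (fun y => g y * cutoffSeq n y) x)
      atTop (𝓝 (∫ x, C x k * partialDeriv k g x)) := fun k => by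
    have h1 := (tendsto_integral_mul_cutoffSeq (hint' k)).add
      (tendsto_integral_mul_partialDeriv_cutoffSeq k (hint k))
    rw [add_zero] at h1
    refine h1.congr fun n => ?_
    rw [← integral_add (hI1 k n) (hI2 k n)]
    simp_rw [hd]
  refine tendsto_nhds_unique (((hlim 0).add (hlim 1)).add (hlim 2)) ?_
  -- For each `n` the truncated function `g * cutoffSeq n` is an admissible test function, so the
  -- sum whose limit is taken is identically zero.
  refine tendsto_const_nhds.congr fun n => ?_
  have hI : ∀ k, Integrable fun x => C x k * partialDeriv k (fun y => g y * cutoffSeq n y) x :=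
    fun k => ((hI1 k n).add (hI2 k n)).congr (Eventually.of_forall fun x => (hd k n x).symm)
  rw [← integral_add_add (hI 0) (hI 1) (hI 2)]
  exact (h.integral_inner_grad (hg.mul (contDiff_cutoffSeq n))
    ((hasCompactSupport_cutoffSeq n).mul_left)).symm

/-! ### The Biot–Savart field and its curl. -/

/-- The Biot–Savart field of `C`. -/
noncomputable def biotSavart (C : E3 → E3) (x : E3) : E3 :=
  !₂[newtonPot 2 (fun y => C y 1) x - newtonPot 1 (fun y => C y 2) x,
     newtonPot 0 (fun y => C y 2) x - newtonPot 2 (fun y => C y 0) x,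
     newtonPot 1 (fun y => C y 0) x - newtonPot 0 (fun y => C y 1) x]

/-- The curl of the Biot–Savart field of a weakly divergence free field `C` is `C`. -/
theorem HasWeakCurl.biotSavart {D C : E3 → E3} (h : HasWeakCurl D C)
    (hm : ∀ k, AEStronglyMeasurable fun y => C y k)
    (hfin : ∀ k, ∫⁻ y, ‖C y k‖ₑ ^ (3 / 2 : ℝ) < ⊤) : HasWeakCurl (biotSavart C) C := by
  intro Φ hΦ hΦ'
  have hs : ∀ i, ContDiff ℝ ∞ fun y => Φ y i := contDiff_component hΦ
  have hc : ∀ i, HasCompactSupport fun y => Φ y i := hasCompactSupport_component hΦ'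
  have hds : ∀ c d, Continuous (partialDeriv c fun y => Φ y d) := fun c d =>
    continuous_partialDeriv c (hs d)
  have hdc : ∀ c d, HasCompactSupport (partialDeriv c fun y => Φ y d) := fun c d =>
    hasCompactSupport_partialDeriv c (hc d)
  -- Antisymmetry moves every kernel onto the test field, so both sides become combinations of the
  -- numbers `T a b c d = ∫ C_b (K_a * ∂_c Φ_d)`.
  set T : Fin 3 → Fin 3 → Fin 3 → Fin 3 → ℝ := fun a b c d =>
    ∫ x, C x b * newtonPot a (partialDeriv c fun y => Φ y d) x with hT
  have hTint : ∀ a b c d,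
      Integrable fun x => C x b * newtonPot a (partialDeriv c fun y => Φ y d) x :=
    fun a b c d => integrable_mul_newtonPot a (hm b) (hfin b) (hds c d) (hdc c d)
  set S : Fin 3 → Fin 3 → Fin 3 → Fin 3 → E3 → ℝ := fun a b c d x =>
    newtonPot a (fun y => C y b) x * partialDeriv c (fun y => Φ y d) x with hS
  have hSint : ∀ a b c d, Integrable (S a b c d) := fun a b c d =>
    integrable_newtonPot_mul a (hm b) (hfin b) (hds c d) (hdc c d)
  have hST : ∀ a b c d, ∫ x, S a b c d x = -T a b c d := fun a b c d =>
    integral_newtonPot_mul a (hm b) (hfin b) (hds c d) (hdc c d)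
  have hleft : ∫ x, inner ℝ (_root_.biotSavart C x) (curl Φ x) =
      -T 2 1 1 2 + T 2 1 2 1 + T 1 2 1 2 - T 1 2 2 1 - T 0 2 2 0 + T 0 2 0 2 + T 2 0 2 0
        - T 2 0 0 2 - T 1 0 0 1 + T 1 0 1 0 + T 0 1 0 1 - T 0 1 1 0 := by
    have hexp : ∀ x, inner ℝ (_root_.biotSavart C x) (curl Φ x) =
        ((S 2 1 1 2 x - S 2 1 2 1 x) - (S 1 2 1 2 x - S 1 2 2 1 x)) +
        ((S 0 2 2 0 x - S 0 2 0 2 x) - (S 2 0 2 0 x - S 2 0 0 2 x)) +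
        ((S 1 0 0 1 x - S 1 0 1 0 x) - (S 0 1 0 1 x - S 0 1 1 0 x)) := fun x => by
      rw [inner_eq_add_add]
      simp only [_root_.biotSavart, curl, hS, PiLp.toLp_apply, Matrix.cons_val_zero,
        Matrix.cons_val_one, Matrix.cons_val]
      ring
    simp_rw [hexp]
    have I4 : ∀ a b c d a' b', Integrable fun x =>
        (S a b c d x - S a b d c x) - (S a' b' c d x - S a' b' d c x) :=
      fun a b c d a' b' => ((hSint a b c d).sub (hSint a b d c)).sub
        ((hSint a' b' c d).sub (hSint a' b' d c))
    rw [integral_add_add (I4 ..) (I4 ..) (I4 ..),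
      integral_sub_sub_sub (hSint ..) (hSint ..) (hSint ..) (hSint ..),
      integral_sub_sub_sub (hSint ..) (hSint ..) (hSint ..) (hSint ..),
      integral_sub_sub_sub (hSint ..) (hSint ..) (hSint ..) (hSint ..)]
    simp only [hST]
    ring
  -- Here `Φ_k` is written as `∑_j K_j * ∂_j Φ_k`, by the fundamental solution property.
  have hrightk : ∀ k, (∫ x, C x k * Φ x k) = T 0 k 0 k + T 1 k 1 k + T 2 k 2 k := fun k => by
    rw [← integral_add_add (hTint ..) (hTint ..) (hTint ..)]
    congr 1 with x
    rw [← sum_newtonPot_partialDeriv (hs k) (hc k) x, Fin.sum_univ_three]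
    ring
  have hIright : ∀ k, Integrable fun x => C x k * Φ x k := fun k => by
    refine (((hTint 0 k 0 k).add (hTint 1 k 1 k)).add (hTint 2 k 2 k)).congr
      (Eventually.of_forall fun x => ?_)
    simp only [Pi.add_apply]
    rw [← sum_newtonPot_partialDeriv (hs k) (hc k) x, Fin.sum_univ_three]
    ring
  have hright : ∫ x, inner ℝ (C x) (Φ x) = (T 0 0 0 0 + T 1 0 1 0 + T 2 0 2 0) +
      (T 0 1 0 1 + T 1 1 1 1 + T 2 1 2 1) + (T 0 2 0 2 + T 1 2 1 2 + T 2 2 2 2) := by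
    simp_rw [inner_eq_add_add]
    rw [integral_add_add (hIright 0) (hIright 1) (hIright 2), hrightk, hrightk, hrightk]
  -- This is the scalar whose gradient is the `grad div` term of `curl curl = grad div - Δ`. It need
  -- not have compact support, which is why orthogonality to gradients was extended beyond test
  -- functions.
  set ψ : E3 → ℝ := fun x => newtonPot 0 (fun y => Φ y 0) x + newtonPot 1 (fun y => Φ y 1) x +
    newtonPot 2 (fun y => Φ y 2) x with hψ
  have hNs : ∀ j, ContDiff ℝ ∞ (newtonPot j fun y => Φ y j) := fun j =>
    contDiff_newtonPot j (hs j) (hc j)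
  have hψs : ContDiff ℝ ∞ ψ := ((hNs 0).add (hNs 1)).add (hNs 2)
  have hψd : ∀ k x, partialDeriv k ψ x = newtonPot 0 (partialDeriv k fun y => Φ y 0) x +
      newtonPot 1 (partialDeriv k fun y => Φ y 1) x +
      newtonPot 2 (partialDeriv k fun y => Φ y 2) x := fun k x => by
    have hd : ∀ j, HasFDerivAt (newtonPot j fun y => Φ y j) _ x := fun j =>
      ((hNs j).differentiable (by simp) x).hasFDerivAt
    have hsum : HasFDerivAt ψ _ x := ((hd 0).add (hd 1)).add (hd 2)
    rw [partialDeriv, hsum.fderiv]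
    simp only [← partialDeriv_newtonPot k _ (hs _) (hc _)]
    rfl
  have hψi : ∀ k, Integrable fun x => C x k * ψ x := fun k => by
    have hi : ∀ j, Integrable fun x => C x k * newtonPot j (fun y => Φ y j) x := fun j =>
      integrable_mul_newtonPot j (hm k) (hfin k) (hs j).continuous (hc j)
    refine (((hi 0).add (hi 1)).add (hi 2)).congr (Eventually.of_forall fun x => ?_)
    simp only [Pi.add_apply, hψ]
    ring
  have hψe : ∀ k x, C x k * partialDeriv k ψ x =
      C x k * newtonPot 0 (partialDeriv k fun y => Φ y 0) x +
      C x k * newtonPot 1 (partialDeriv k fun y => Φ y 1) x +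
      C x k * newtonPot 2 (partialDeriv k fun y => Φ y 2) x := fun k x => by
    rw [hψd]
    ring
  have hψi' : ∀ k, Integrable fun x => C x k * partialDeriv k ψ x := fun k => by
    simp_rw [hψe]
    exact ((hTint ..).add (hTint ..)).add (hTint ..)
  have hψk : ∀ k, ∫ x, C x k * partialDeriv k ψ x = T 0 k k 0 + T 1 k k 1 + T 2 k k 2 :=
    fun k => by
    simp_rw [hψe]
    rw [integral_add_add (hTint ..) (hTint ..) (hTint ..)]
  have hzero := h.integral_inner_grad_of_integrable hψs hψi hψi'
  rw [hψk, hψk, hψk] at hzero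
  -- The right side minus the left side is the sum of `T j k k j` over all `j`, `k`, that is `∫ C ·
  -- ∇ψ`, which is zero.
  rw [hleft, hright]
  linarith

/-! ### The averaged homotopy operator. -/

/-- The dilation contributes the factor `c⁻³`, at most `8` once `c ≥ 1/2`. -/
theorem lintegral_comp_smul_add_le {h : E3 → ℝ≥0∞} (hh : Measurable h) {c : ℝ} (hc : 1 / 2 ≤ c)
    (v : E3) : ∫⁻ x, h (c • x + v) ≤ 8 * ∫⁻ x, h x := by
  have hc0 : 0 < c := by linarith
  have hm : Measurable fun x => h (x + v) := hh.comp (measurable_id.add_const v)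
  calc ∫⁻ x, h (c • x + v) = ∫⁻ y, h (y + v) ∂(Measure.map (c • ·) volume) :=
        (lintegral_map hm (measurable_const_smul c)).symm
    _ = ENNReal.ofReal |(c ^ 3)⁻¹| * ∫⁻ x, h x := by
        rw [Measure.map_addHaar_smul _ hc0.ne', lintegral_smul_measure,
          lintegral_add_right_eq_self]
        simp
    _ ≤ 8 * ∫⁻ x, h x := by
        gcongr
        rw [show (8 : ℝ≥0∞) = ENNReal.ofReal 8 by norm_num, abs_of_pos (by positivity)]
        apply ENNReal.ofReal_le_ofReal
        rw [inv_le_comm₀ (by positivity) (by norm_num)]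
        calc (8 : ℝ)⁻¹ = (1 / 2) ^ 3 := by norm_num
          _ ≤ c ^ 3 := by gcongr

/-- The parameter measure: the starting point ranges over the unit ball, and the position on the
segment over the unit interval. -/
noncomputable abbrev segmentMeasure : Measure (E3 × ℝ) :=
  (volume.restrict (Metric.ball (0 : E3) 1)).prod (volume.restrict (Set.Ioo (0 : ℝ) 1))

/-- The integrand of the averaged homotopy operator. -/
noncomputable def homotopyIntegrand (F : E3 → E3) (x : E3) (p : E3 × ℝ) : ℝ :=
  inner ℝ (F (p.1 + p.2 • (x - p.1))) (x - p.1)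

/-- The averaged homotopy operator, which inverts the gradient. -/
noncomputable def homotopyOp (F : E3 → E3) (x : E3) : ℝ :=
  ∫ p, homotopyIntegrand F x p ∂segmentMeasure

theorem measurable_homotopyIntegrand {F : E3 → E3} (hF : Measurable F) :
    Measurable fun q : E3 × (E3 × ℝ) => homotopyIntegrand F q.1 q.2 := by
  unfold homotopyIntegrand
  refine Measurable.inner (hF.comp ?_) ?_ <;> fun_prop

/-- This is where averaging over the base point `a` pays. For `t ≥ 1/2` the change of variables is
made in `x`, with Jacobian factor `t⁻³`; for `t ≤ 1/2` it is made in `a`, with factor `(1 - t)⁻³`.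
With a fixed base point the factor `t⁻³` would not be integrable at `0`. -/
theorem lintegral_segment_le {h : E3 → ℝ≥0∞} (hh : Measurable h) {R : ℝ} (hR : 1 ≤ R) :
    ∫⁻ x in Metric.ball 0 R, ∫⁻ p, h (p.1 + p.2 • (x - p.1)) ∂segmentMeasure ≤
      8 * volume (Metric.ball (0 : E3) R) * ∫⁻ x, h x := by
  have hm : Measurable fun q : E3 × (E3 × ℝ) => h (q.2.1 + q.2.2 • (q.1 - q.2.1)) :=
    hh.comp (by fun_prop)
  have hv1 : volume (Metric.ball (0 : E3) 1) ≤ volume (Metric.ball (0 : E3) R) :=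
    measure_mono (Metric.ball_subset_ball hR)
  have hm' : ∀ t : ℝ, Measurable fun q : E3 × E3 => h (q.1 + t • (q.2 - q.1)) := fun t =>
    hh.comp (by fun_prop)
  have hin : ∀ t : ℝ, ∫⁻ a in Metric.ball (0 : E3) 1, ∫⁻ x in Metric.ball (0 : E3) R,
      h (a + t • (x - a)) ≤ 8 * volume (Metric.ball (0 : E3) R) * ∫⁻ x, h x := fun t => by
    rcases le_total (1 / 2) t with ht | ht
    · calc _ ≤ ∫⁻ a in Metric.ball (0 : E3) 1, 8 * ∫⁻ x, h x := by
            refine lintegral_mono fun a => (setLIntegral_le_lintegral _ _).trans ?_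
            refine le_trans (le_of_eq (lintegral_congr fun x => ?_))
              (lintegral_comp_smul_add_le hh ht ((1 - t) • a))
            congr 1
            module
        _ = 8 * volume (Metric.ball (0 : E3) 1) * ∫⁻ x, h x := by
            rw [setLIntegral_const]; ring
        _ ≤ _ := by gcongr
    · rw [lintegral_lintegral_swap (hm' t).aemeasurable]
      calc _ ≤ ∫⁻ x in Metric.ball (0 : E3) R, 8 * ∫⁻ x, h x := by
            refine lintegral_mono fun x => (setLIntegral_le_lintegral _ _).trans ?_
            refine le_trans (le_of_eq (lintegral_congr fun a => ?_))
              (lintegral_comp_smul_add_le hh (by linarith : 1 / 2 ≤ 1 - t) (t • x))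
            congr 1
            module
        _ = _ := by rw [setLIntegral_const]; ring
  calc _ = ∫⁻ p, (∫⁻ x in Metric.ball 0 R, h (p.1 + p.2 • (x - p.1))) ∂segmentMeasure :=
        lintegral_lintegral_swap hm.aemeasurable
    _ = ∫⁻ t in Set.Ioo (0 : ℝ) 1, ∫⁻ a in Metric.ball (0 : E3) 1,
          ∫⁻ x in Metric.ball 0 R, h (a + t • (x - a)) := by
        rw [lintegral_prod_symm _ (Measurable.lintegral_prod_left' hm).aemeasurable]
    _ ≤ ∫⁻ _ in Set.Ioo (0 : ℝ) 1, 8 * volume (Metric.ball (0 : E3) R) * ∫⁻ x, h x :=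
        lintegral_mono hin
    _ = _ := by rw [setLIntegral_const]; simp

/-- The constant in the `L¹` bound of the homotopy operator on the ball of radius `R`. -/
noncomputable def homotopyConst (R : ℝ) : ℝ≥0∞ :=
  ENNReal.ofReal (2 * R) * (8 * volume (Metric.ball (0 : E3) R))

theorem homotopyConst_lt_top (R : ℝ) : homotopyConst R < ⊤ :=
  ENNReal.mul_lt_top ENNReal.ofReal_lt_top (ENNReal.mul_lt_top (by norm_num) measure_ball_lt_top)

theorem ae_segmentMeasure :
    ∀ᵐ p ∂segmentMeasure, p ∈ Metric.ball (0 : E3) 1 ×ˢ Set.Ioo (0 : ℝ) 1 := by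
  rw [segmentMeasure, Measure.prod_restrict]
  exact ae_restrict_mem (measurableSet_ball.prod measurableSet_Ioo)

theorem lintegral_homotopyIntegrand_le {F : E3 → E3} (hF : Measurable F) {R : ℝ} (hR : 1 ≤ R) :
    ∫⁻ x in Metric.ball 0 R, ∫⁻ p, ‖homotopyIntegrand F x p‖ₑ ∂segmentMeasure ≤
      homotopyConst R * ∫⁻ x in Metric.ball 0 R, ‖F x‖ₑ := by
  set h : E3 → ℝ≥0∞ := (Metric.ball 0 R).indicator fun x => ‖F x‖ₑ with hh
  have hhm : Measurable h := hF.enorm.indicator measurableSet_ball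
  calc _ ≤ ∫⁻ x in Metric.ball 0 R, ∫⁻ p,
        ENNReal.ofReal (2 * R) * h (p.1 + p.2 • (x - p.1)) ∂segmentMeasure := by
        refine setLIntegral_mono' measurableSet_ball fun x hx => lintegral_mono_ae ?_
        filter_upwards [ae_segmentMeasure] with p hp
        have ha : p.1 ∈ Metric.ball (0 : E3) R := Metric.ball_subset_ball hR hp.1
        have hz : p.1 + p.2 • (x - p.1) ∈ Metric.ball (0 : E3) R :=
          (convex_ball (0 : E3) R).add_smul_sub_mem ha hx ⟨hp.2.1.le, hp.2.2.le⟩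
        rw [hh, Set.indicator_of_mem hz, mul_comm, homotopyIntegrand]
        have hxa : ‖x - p.1‖ ≤ 2 * R := by
          rw [mem_ball_zero_iff] at ha hx
          linarith [norm_sub_le x p.1]
        rw [← ofReal_norm, ← ofReal_norm, ← ENNReal.ofReal_mul (norm_nonneg _)]
        apply ENNReal.ofReal_le_ofReal
        exact (norm_inner_le_norm _ _).trans (by gcongr)
    _ = ENNReal.ofReal (2 * R) * ∫⁻ x in Metric.ball 0 R, ∫⁻ p,
          h (p.1 + p.2 • (x - p.1)) ∂segmentMeasure := by
        simp_rw [lintegral_const_mul' _ _ ENNReal.ofReal_ne_top]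
    _ ≤ ENNReal.ofReal (2 * R) * (8 * volume (Metric.ball (0 : E3) R) * ∫⁻ x, h x) := by
        gcongr
        exact lintegral_segment_le hhm hR
    _ = _ := by
        rw [hh, lintegral_indicator measurableSet_ball, homotopyConst]; ring

theorem integrable_homotopyIntegrand {F : E3 → E3} (hF : Measurable F)
    (hF' : LocallyIntegrable F) {R : ℝ} (hR : 1 ≤ R) :
    Integrable (fun q : E3 × (E3 × ℝ) => homotopyIntegrand F q.1 q.2)
      ((volume.restrict (Metric.ball (0 : E3) R)).prod segmentMeasure) := by
  have hm := measurable_homotopyIntegrand hF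
  refine ⟨hm.aestronglyMeasurable, ?_⟩
  rw [hasFiniteIntegral_iff_enorm, lintegral_prod _ hm.enorm.aemeasurable]
  refine (lintegral_homotopyIntegrand_le hF hR).trans_lt
    (ENNReal.mul_lt_top (homotopyConst_lt_top R) ?_)
  have := (hF'.integrableOn_isCompact (isCompact_closedBall (0 : E3) R)).mono_set
    Metric.ball_subset_closedBall
  exact this.2

theorem integrableOn_homotopyOp {F : E3 → E3} (hF : Measurable F) (hF' : LocallyIntegrable F)
    {R : ℝ} (hR : 1 ≤ R) : IntegrableOn (homotopyOp F) (Metric.ball 0 R) :=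
  (integrable_homotopyIntegrand hF hF' hR).integral_prod_left

theorem locallyIntegrable_homotopyOp {F : E3 → E3} (hF : Measurable F)
    (hF' : LocallyIntegrable F) : LocallyIntegrable (homotopyOp F) := fun x =>
  ⟨Metric.ball 0 (‖x‖ + 1), Metric.isOpen_ball.mem_nhds (by simp),
    integrableOn_homotopyOp hF hF' (by linarith [norm_nonneg x])⟩

/-- The homotopy operator is Lipschitz for the `L¹` distance on balls. -/
theorem lintegral_homotopyOp_sub_le {F G : E3 → E3} (hF : Measurable F)
    (hF' : LocallyIntegrable F) (hG : Measurable G) (hG' : LocallyIntegrable G) {R : ℝ}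
    (hR : 1 ≤ R) :
    ∫⁻ x in Metric.ball 0 R, ‖homotopyOp F x - homotopyOp G x‖ₑ ≤
      homotopyConst R * ∫⁻ x in Metric.ball 0 R, ‖F x - G x‖ₑ := by
  refine le_trans (lintegral_mono_ae ?_) (lintegral_homotopyIntegrand_le (hF.sub hG) hR)
  filter_upwards [(integrable_homotopyIntegrand hF hF' hR).prod_right_ae,
    (integrable_homotopyIntegrand hG hG' hR).prod_right_ae] with x h1 h2
  rw [homotopyOp, homotopyOp, ← integral_sub h1 h2]
  refine (enorm_integral_le_lintegral_enorm _).trans_eq (lintegral_congr fun p => ?_)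
  simp [homotopyIntegrand, inner_sub_left]

/-- The Poincaré lemma for smooth vector fields. -/
theorem exists_hasFDerivAt_of_partialDeriv_symm {F : E3 → E3} (hF : ContDiff ℝ ∞ F)
    (hsymm : ∀ i j x, partialDeriv i (fun y => F y j) x = partialDeriv j (fun y => F y i) x) :
    ∃ φ : E3 → ℝ, ∀ x, HasFDerivAt φ (innerSL ℝ (F x)) x := by
  have hd : ∀ x, HasFDerivAt (fun y => innerSL ℝ (F y)) ((innerSL ℝ).comp (fderiv ℝ F x)) x :=
    fun x => (innerSL ℝ).hasFDerivAt.comp x (hF.differentiable (by simp) x).hasFDerivAt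
  have hc : ∀ x u j, (fderiv ℝ F x u) j = ∑ i, u i * partialDeriv i (fun y => F y j) x :=
    fun x u j => by
    rw [← fderiv_apply_eq_sum_partialDeriv]
    have h1 : HasFDerivAt (fun y => F y j) _ x :=
      (EuclideanSpace.proj (𝕜 := ℝ) j).hasFDerivAt.comp x
        (hF.differentiable (by simp) x).hasFDerivAt
    rw [h1.fderiv]
    rfl
  obtain ⟨φ, hφ⟩ := convex_univ.exists_forall_hasFDerivAt_of_fderiv_symmetric isOpen_univ
    (fun x _ => (hd x).differentiableAt.differentiableWithinAt)
    (fun x _ u v => by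
      rw [(hd x).fderiv]
      change inner ℝ (fderiv ℝ F x u) v = inner ℝ (fderiv ℝ F x v) u
      rw [inner_eq_add_add, inner_eq_add_add]
      simp only [hc, Fin.sum_univ_three]
      rw [hsymm 1 0, hsymm 2 0, hsymm 2 1]
      ring)
  exact ⟨φ, fun x => hφ x trivial⟩

theorem integral_segment_eq_sub {F : E3 → E3} (hF : Continuous F) {φ : E3 → ℝ}
    (hφ : ∀ x, HasFDerivAt φ (innerSL ℝ (F x)) x) (x a : E3) :
    ∫ t in Set.Ioo (0 : ℝ) 1, homotopyIntegrand F x (a, t) = φ x - φ a := by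
  rw [← integral_Ioc_eq_integral_Ioo, ← intervalIntegral.integral_of_le zero_le_one]
  have hd : ∀ t : ℝ, HasDerivAt (fun t : ℝ => φ (a + t • (x - a)))
      (homotopyIntegrand F x (a, t)) t := fun t => by
    have h1 : HasDerivAt (fun t : ℝ => a + t • (x - a)) (x - a) t := by
      simpa using ((hasDerivAt_id t).smul_const (x - a)).const_add a
    exact (hφ _).comp_hasDerivAt t h1
  have hc : Continuous fun t : ℝ => homotopyIntegrand F x (a, t) := by
    unfold homotopyIntegrand
    fun_prop
  rw [intervalIntegral.integral_eq_sub_of_hasDerivAt (fun t _ => hd t) (hc.intervalIntegrable _ _)]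
  simp

/-- Each segment contributes `φ x - φ a`. The volume factor appears because `segmentMeasure` is not
normalized, and the equality is almost everywhere because Fubini supplies integrability in `p` only
for almost every `x`. -/
theorem ae_homotopyOp_eq {F : E3 → E3} (hF : Continuous F) {φ : E3 → ℝ}
    (hφ : ∀ x, HasFDerivAt φ (innerSL ℝ (F x)) x) {R : ℝ} (hR : 1 ≤ R) :
    ∀ᵐ x ∂(volume.restrict (Metric.ball (0 : E3) R)), homotopyOp F x =
      volume.real (Metric.ball (0 : E3) 1) * φ x - ∫ a in Metric.ball (0 : E3) 1, φ a := by
  have hφc : Continuous φ := continuous_iff_continuousAt.2 fun x => (hφ x).continuousAt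
  have hφi : IntegrableOn φ (Metric.ball (0 : E3) 1) :=
    (hφc.continuousOn.integrableOn_compact (isCompact_closedBall (0 : E3) 1)).mono_set
      Metric.ball_subset_closedBall
  filter_upwards [(integrable_homotopyIntegrand hF.measurable hF.locallyIntegrable
    hR).prod_right_ae] with x hx
  rw [homotopyOp, segmentMeasure, integral_prod _ hx]
  simp_rw [integral_segment_eq_sub hF hφ x]
  have hci : IntegrableOn (fun _ => φ x) (Metric.ball (0 : E3) 1) :=
    integrableOn_const measure_ball_lt_top.ne
  rw [integral_sub hci hφi, setIntegral_const, smul_eq_mul]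

theorem integral_partialDeriv_mul_eq {φ ψ : E3 → ℝ} (hφ : ContDiff ℝ 1 φ) (hψ : ContDiff ℝ ∞ ψ)
    (hψ' : HasCompactSupport ψ) (i : Fin 3) :
    ∫ x, φ x * partialDeriv i ψ x = -∫ x, partialDeriv i φ x * ψ x := by
  have hc : Continuous (partialDeriv i φ) :=
    (hφ.continuous_fderiv one_ne_zero).clm_apply continuous_const
  exact integral_mul_fderiv_eq_neg_fderiv_mul_of_integrable
    ((hc.mul hψ.continuous).integrable_of_hasCompactSupport hψ'.mul_left)
    ((hφ.continuous.mul (continuous_partialDeriv i hψ)).integrable_of_hasCompactSupport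
      (hasCompactSupport_partialDeriv i hψ').mul_left)
    ((hφ.continuous.mul hψ.continuous).integrable_of_hasCompactSupport hψ'.mul_left)
    (fun x _ => hφ.differentiable one_ne_zero x) (fun x _ => hψ.differentiable (by simp) x)

/-- The additive constant drops out because `∂ᵢη` has integral zero. The resulting identity no
longer mentions `φ`, so it can pass to limits in `F`. -/
theorem integral_homotopyOp_mul_of_primitive {F : E3 → E3} (hF : Continuous F) {φ : E3 → ℝ}
    (hφ : ∀ x, HasFDerivAt φ (innerSL ℝ (F x)) x) {η : E3 → ℝ} (hη : ContDiff ℝ ∞ η)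
    (hη' : HasCompactSupport η) (i : Fin 3) :
    ∫ x, homotopyOp F x * partialDeriv i η x =
      -(volume.real (Metric.ball (0 : E3) 1) * ∫ x, F x i * η x) := by
  have hfd : fderiv ℝ φ = fun x => innerSL ℝ (F x) := funext fun x => (hφ x).fderiv
  have hφ1 : ContDiff ℝ 1 φ := by
    rw [contDiff_one_iff_fderiv, hfd]
    exact ⟨fun x => (hφ x).differentiableAt, (innerSL ℝ).continuous.comp hF⟩
  have hpd : ∀ x, partialDeriv i φ x = F x i := fun x => by
    rw [partialDeriv, hfd]
    simp [EuclideanSpace.inner_single_right]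
  obtain ⟨R, hR⟩ := hη'.isCompact.isBounded.subset_ball 0
  have hR1 : tsupport η ⊆ Metric.ball 0 (max R 1) :=
    hR.trans (Metric.ball_subset_ball (le_max_left _ _))
  set V := volume.real (Metric.ball (0 : E3) 1)
  set c := ∫ a in Metric.ball (0 : E3) 1, φ a
  have h1 := ae_homotopyOp_eq hF hφ (le_max_right R 1)
  rw [ae_restrict_iff' measurableSet_ball] at h1
  have h2 : ∫ x, homotopyOp F x * partialDeriv i η x =
      ∫ x, (V * (φ x * partialDeriv i η x) - c * (1 * partialDeriv i η x)) := by
    refine integral_congr_ae ?_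
    filter_upwards [h1] with x hx
    by_cases hxs : x ∈ tsupport η
    · rw [hx (hR1 hxs)]
      ring
    · have : partialDeriv i η x = 0 := by
        rw [partialDeriv, fderiv_of_notMem_tsupport ℝ hxs]
        rfl
      simp [this]
  have hi1 : Integrable fun x => φ x * partialDeriv i η x :=
    (hφ1.continuous.mul (continuous_partialDeriv i hη)).integrable_of_hasCompactSupport
      (hasCompactSupport_partialDeriv i hη').mul_left
  have hi2 : Integrable fun x => 1 * partialDeriv i η x :=
    (continuous_const.mul (continuous_partialDeriv i hη)).integrable_of_hasCompactSupport
      (hasCompactSupport_partialDeriv i hη').mul_left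
  rw [h2, integral_sub (hi1.const_mul V) (hi2.const_mul c), integral_const_mul, integral_const_mul,
    integral_partialDeriv_mul_eq hφ1 hη hη' i,
    integral_partialDeriv_mul_eq (φ := fun _ => 1) contDiff_const hη hη' i]
  simp only [hpd]
  simp [partialDeriv]

/-! ### Mollification and local `L¹` convergence. -/

/-- A sequence of bump functions whose supports shrink to the origin. -/
noncomputable def mollifierBump (k : ℕ) : ContDiffBump (0 : E3) where
  rIn := 1 / ((k : ℝ) + 1) / 2
  rOut := 1 / ((k : ℝ) + 1)
  rIn_pos := by positivity
  rIn_lt_rOut := half_lt_self (by positivity)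

/-- A sequence of standard mollifiers. -/
noncomputable def mollifier (k : ℕ) : E3 → ℝ := (mollifierBump k).normed volume

theorem contDiff_mollifier (k : ℕ) : ContDiff ℝ ∞ (mollifier k) :=
  (mollifierBump k).contDiff_normed

theorem hasCompactSupport_mollifier (k : ℕ) : HasCompactSupport (mollifier k) :=
  (mollifierBump k).hasCompactSupport_normed

theorem mollifier_eq_zero {k : ℕ} {t : E3} (ht : 1 ≤ ‖t‖) : mollifier k t = 0 := by
  by_contra h
  have h1 : t ∈ Function.support ((mollifierBump k).normed volume) := h
  rw [(mollifierBump k).support_normed_eq, mem_ball_zero_iff] at h1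
  have h2 : (mollifierBump k).rOut ≤ 1 := by
    change 1 / ((k : ℝ) + 1) ≤ 1
    rw [div_le_one (by positivity)]
    linarith [(Nat.cast_nonneg k : (0 : ℝ) ≤ k)]
  linarith

theorem lintegral_enorm_mollifier (k : ℕ) : ∫⁻ t, ‖mollifier k t‖ₑ = 1 := by
  have h0 : ∀ t, 0 ≤ mollifier k t := (mollifierBump k).nonneg_normed
  simp_rw [fun t => Real.enorm_of_nonneg (h0 t)]
  rw [← ofReal_integral_eq_lintegral_ofReal
    ((contDiff_mollifier k).continuous.integrable_of_hasCompactSupport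
      (hasCompactSupport_mollifier k)) (Eventually.of_forall h0), mollifier,
    (mollifierBump k).integral_normed, ENNReal.ofReal_one]

/-- The mollification of a scalar function. -/
noncomputable def mollify (k : ℕ) (f : E3 → ℝ) : E3 → ℝ :=
  convolution f (mollifier k) (ContinuousLinearMap.mul ℝ ℝ) volume

theorem mollify_apply (k : ℕ) (f : E3 → ℝ) (x : E3) :
    mollify k f x = ∫ t, f t * mollifier k (x - t) := rfl

theorem mollify_eq_convolution (k : ℕ) (f : E3 → ℝ) :
    mollify k f = convolution ((mollifierBump k).normed volume) f
      (ContinuousLinearMap.lsmul ℝ ℝ) volume := by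
  ext x
  rw [mollify, convolution_eq_swap, convolution_def]
  simp [mollifier, mul_comm]

theorem contDiff_mollify (k : ℕ) {f : E3 → ℝ} (hf : LocallyIntegrable f) :
    ContDiff ℝ ∞ (mollify k f) :=
  (hasCompactSupport_mollifier k).contDiff_convolution_right _ hf (contDiff_mollifier k)

theorem partialDeriv_mollify (i : Fin 3) (k : ℕ) {f : E3 → ℝ} (hf : LocallyIntegrable f) (x : E3) :
    partialDeriv i (mollify k f) x = ∫ t, f t * partialDeriv i (mollifier k) (x - t) := by
  rw [mollify, partialDeriv,
    ((hasCompactSupport_mollifier k).hasFDerivAt_convolution_right (ContinuousLinearMap.mul ℝ ℝ)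
      hf ((contDiff_mollifier k).of_le (by simp)) x).fderiv,
    convolution_precompR_apply _ hf ((hasCompactSupport_mollifier k).fderiv ℝ)
      ((contDiff_mollifier k).continuous_fderiv (by simp))]
  rfl

theorem integrable_mollify_integrand (k : ℕ) {f : E3 → ℝ} (hf : LocallyIntegrable f) (x : E3) :
    Integrable fun t => f t * mollifier k (x - t) :=
  (hasCompactSupport_mollifier k).convolutionExists_right (ContinuousLinearMap.mul ℝ ℝ) hf
    (contDiff_mollifier k).continuous x

theorem mollify_sub (k : ℕ) {f g : E3 → ℝ} (hf : LocallyIntegrable f) (hg : LocallyIntegrable g)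
    (x : E3) : mollify k f x - mollify k g x = mollify k (f - g) x := by
  rw [mollify_apply, mollify_apply, mollify_apply, ← integral_sub
    (integrable_mollify_integrand k hf x) (integrable_mollify_integrand k hg x)]
  simp [sub_mul]

theorem lintegral_enorm_mollify_le (k : ℕ) {f : E3 → ℝ} (hf : AEStronglyMeasurable f) :
    ∫⁻ x, ‖mollify k f x‖ₑ ≤ ∫⁻ x, ‖f x‖ₑ := by
  have hm : AEMeasurable (fun p : E3 × E3 => ‖f p.2‖ₑ * ‖mollifier k (p.1 - p.2)‖ₑ)
      (volume.prod volume) :=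
    hf.comp_snd.enorm.mul ((contDiff_mollifier k).continuous.measurable.comp
      (measurable_fst.sub measurable_snd)).enorm.aemeasurable
  calc ∫⁻ x, ‖mollify k f x‖ₑ ≤ ∫⁻ x, ∫⁻ t, ‖f t‖ₑ * ‖mollifier k (x - t)‖ₑ := by
        refine lintegral_mono fun x => (enorm_integral_le_lintegral_enorm _).trans_eq ?_
        exact lintegral_congr fun t => enorm_mul _ _
    _ = ∫⁻ t, ∫⁻ x, ‖f t‖ₑ * ‖mollifier k (x - t)‖ₑ := lintegral_lintegral_swap hm
    _ = ∫⁻ t, ‖f t‖ₑ := by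
        refine lintegral_congr fun t => ?_
        rw [lintegral_const_mul' _ _ enorm_ne_top,
          lintegral_sub_right_eq_self (fun x => ‖mollifier k x‖ₑ) t, lintegral_enorm_mollifier,
          mul_one]

theorem eventually_dist_mollify_le {g : E3 → ℝ} (hg : Continuous g) (hg' : HasCompactSupport g)
    {ε : ℝ} (hε : 0 < ε) : ∀ᶠ k in atTop, ∀ x, dist (mollify k g x) (g x) ≤ ε := by
  obtain ⟨δ, hδ, h⟩ := Metric.uniformContinuous_iff.1
    (hg'.uniformContinuous_of_continuous hg) ε hε
  have h1 : ∀ᶠ k : ℕ in atTop, 1 / ((k : ℝ) + 1) < δ :=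
    (tendsto_one_div_add_atTop_nhds_zero_nat (𝕜 := ℝ)).eventually_lt_const hδ
  filter_upwards [h1] with k hk x
  rw [mollify_eq_convolution]
  exact (mollifierBump k).dist_normed_convolution_le hg.aestronglyMeasurable
    fun y hy => (h (lt_trans hy hk)).le

/-- All mollifiers vanish outside the unit ball, so values on a ball of radius `R` only see the ball
of radius `R + 1`. -/
theorem mollify_congr_of_mem_ball (k : ℕ) (f : E3 → ℝ) {R : ℝ} {x : E3}
    (hx : x ∈ Metric.ball (0 : E3) R) :
    mollify k f x = mollify k ((Metric.ball 0 (R + 1)).indicator f) x := by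
  rw [mollify_apply, mollify_apply]
  congr 1 with t
  by_cases ht : t ∈ Metric.ball (0 : E3) (R + 1)
  · rw [Set.indicator_of_mem ht]
  · rw [mollifier_eq_zero, mul_zero, mul_zero]
    rw [mem_ball_zero_iff] at hx ht
    have := norm_sub_norm_le t x
    rw [norm_sub_rev] at this
    linarith

/-- Compactly supported continuous functions are dense in `L¹` and mollify uniformly; mollification
is an `L¹` contraction, which controls the remainder. -/
theorem tendsto_lintegral_mollify_sub_of_integrable {f : E3 → ℝ} (hf : Integrable f) {S : Set E3}
    (hS : volume S < ⊤) :
    Tendsto (fun k => ∫⁻ x in S, ‖mollify k f x - f x‖ₑ) atTop (𝓝 0) := by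
  rw [ENNReal.tendsto_nhds_zero]
  intro ε hε
  rcases eq_or_ne ε ⊤ with rfl | hεtop
  · simp
  have hε3 : ε / 3 ≠ 0 := (ENNReal.div_pos hε.ne' (by norm_num)).ne'
  obtain ⟨g, hgs, hgle, hgc, hgi⟩ := hf.exists_hasCompactSupport_lintegral_sub_le hε3
  obtain ⟨δ, hδ, hδS⟩ : ∃ δ : ℝ, 0 < δ ∧ ENNReal.ofReal δ * volume S ≤ ε / 3 := by
    have h1 : Tendsto (fun δ : ℝ => ENNReal.ofReal δ * volume S) (𝓝[>] 0) (𝓝 0) := by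
      have h2 : Tendsto (fun δ : ℝ => ENNReal.ofReal δ) (𝓝[>] 0) (𝓝 0) := by
        simpa using (ENNReal.continuous_ofReal.tendsto 0).mono_left nhdsWithin_le_nhds
      simpa using ENNReal.Tendsto.mul_const h2 (Or.inr hS.ne)
    obtain ⟨δ, h3, h4⟩ := ((ENNReal.tendsto_nhds_zero.1 h1 (ε / 3)
      (pos_iff_ne_zero.2 hε3)).and self_mem_nhdsWithin).exists
    exact ⟨δ, h4, h3⟩
  have hfg : AEStronglyMeasurable (f - g) := (hf.sub hgi).aestronglyMeasurable
  filter_upwards [eventually_dist_mollify_le hgc hgs hδ] with k hk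
  have hpt : ∀ x, ‖mollify k f x - f x‖ₑ ≤
      ‖mollify k (f - g) x‖ₑ + (ENNReal.ofReal δ + ‖(f - g) x‖ₑ) := fun x => by
    have : mollify k f x - f x = mollify k (f - g) x + ((mollify k g x - g x) - (f - g) x) := by
      rw [← mollify_sub k hf.locallyIntegrable hgi.locallyIntegrable, Pi.sub_apply]
      ring
    rw [this]
    refine (enorm_add_le _ _).trans ?_
    gcongr
    refine enorm_sub_le.trans ?_
    gcongr
    rw [← ofReal_norm]
    exact ENNReal.ofReal_le_ofReal (hk x)
  calc _ ≤ ∫⁻ x in S, (‖mollify k (f - g) x‖ₑ + (ENNReal.ofReal δ + ‖(f - g) x‖ₑ)) :=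
        lintegral_mono hpt
    _ = (∫⁻ x in S, ‖mollify k (f - g) x‖ₑ) + (ENNReal.ofReal δ * volume S +
          ∫⁻ x in S, ‖(f - g) x‖ₑ) := by
        rw [lintegral_add_left' (contDiff_mollify k
          (hf.sub hgi).locallyIntegrable).continuous.enorm.aemeasurable,
          lintegral_add_left' aemeasurable_const, setLIntegral_const]
    _ ≤ ε / 3 + (ε / 3 + ε / 3) := by
        gcongr
        · exact (setLIntegral_le_lintegral _ _).trans
            ((lintegral_enorm_mollify_le k hfg).trans hgle)
        · exact (setLIntegral_le_lintegral _ _).trans hgle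
    _ = ε := by rw [← add_assoc]; exact ENNReal.add_thirds ε

/-- Mollifications of a locally integrable function converge in `L¹` on balls. -/
theorem tendsto_lintegral_mollify_sub {f : E3 → ℝ} (hf : LocallyIntegrable f) (R : ℝ) :
    Tendsto (fun k => ∫⁻ x in Metric.ball 0 R, ‖mollify k f x - f x‖ₑ) atTop (𝓝 0) := by
  have hi : Integrable ((Metric.ball 0 (R + 1)).indicator f) := by
    rw [integrable_indicator_iff measurableSet_ball]
    exact (hf.integrableOn_isCompact (isCompact_closedBall (0 : E3) (R + 1))).mono_set
      Metric.ball_subset_closedBall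
  refine (tendsto_lintegral_mollify_sub_of_integrable hi
    (measure_ball_lt_top (x := (0 : E3)) (r := R))).congr fun k => ?_
  refine setLIntegral_congr_fun measurableSet_ball fun x hx => ?_
  rw [← mollify_congr_of_mem_ball k f hx, Set.indicator_of_mem
    (Metric.ball_subset_ball (by linarith) hx)]

theorem MeasureTheory.LocallyIntegrable.integrable_mul_of_hasCompactSupport {f g : E3 → ℝ}
    (hf : LocallyIntegrable f) (hg : Continuous g) (hg' : HasCompactSupport g) :
    Integrable fun x => f x * g x := by
  simpa [mul_comm] using hf.integrable_smul_left_of_hasCompactSupport hg hg'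

theorem locallyIntegrable_component {F : E3 → E3} (hF : LocallyIntegrable F) (i : Fin 3) :
    LocallyIntegrable fun x => F x i := fun x => by
  obtain ⟨s, hs, hi⟩ := hF x
  exact ⟨s, hs, (EuclideanSpace.proj (𝕜 := ℝ) i).integrable_comp hi⟩

theorem enorm_le_add_add (v : E3) : ‖v‖ₑ ≤ ‖v 0‖ₑ + ‖v 1‖ₑ + ‖v 2‖ₑ := by
  conv_lhs => rw [← (EuclideanSpace.basisFun (Fin 3) ℝ).sum_repr v, Fin.sum_univ_three]
  refine (enorm_add_le _ _).trans (add_le_add ((enorm_add_le _ _).trans (add_le_add ?_ ?_)) ?_)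
    <;> simp [norm_smul, ← ofReal_norm]

/-- Local `L¹` convergence implies convergence of the pairings with test functions. -/
theorem tendsto_integral_mul_of_tendsto_lintegral_ball {f : ℕ → E3 → ℝ} {f₀ g : E3 → ℝ}
    (hf : ∀ k, LocallyIntegrable (f k)) (hf₀ : LocallyIntegrable f₀)
    (hlim : ∀ R : ℝ, 1 ≤ R →
      Tendsto (fun k => ∫⁻ x in Metric.ball 0 R, ‖f k x - f₀ x‖ₑ) atTop (𝓝 0))
    (hg : Continuous g) (hg' : HasCompactSupport g) :
    Tendsto (fun k => ∫ x, f k x * g x) atTop (𝓝 (∫ x, f₀ x * g x)) := by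
  obtain ⟨R, hR⟩ := hg'.isCompact.isBounded.subset_ball 0
  obtain ⟨M, hM⟩ := hg.bounded_above_of_compact_support hg'
  have hR1 : tsupport g ⊆ Metric.ball 0 (max R 1) :=
    hR.trans (Metric.ball_subset_ball (le_max_left _ _))
  refine tendsto_integral_of_L1 _ (hf₀.integrable_mul_of_hasCompactSupport hg hg').aestronglyMeasurable
    (Eventually.of_forall fun k => (hf k).integrable_mul_of_hasCompactSupport hg hg') ?_
  have h0 : Tendsto (fun k => ENNReal.ofReal M *
      ∫⁻ x in Metric.ball 0 (max R 1), ‖f k x - f₀ x‖ₑ) atTop (𝓝 0) := by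
    simpa using ENNReal.Tendsto.const_mul (hlim _ (le_max_right R 1))
      (Or.inr ENNReal.ofReal_ne_top)
  refine tendsto_of_tendsto_of_tendsto_of_le_of_le tendsto_const_nhds h0 (fun k => zero_le)
    fun k => ?_
  rw [← lintegral_const_mul' _ _ ENNReal.ofReal_ne_top, ← lintegral_indicator measurableSet_ball]
  refine lintegral_mono fun x => ?_
  by_cases hx : x ∈ tsupport g
  · rw [Set.indicator_of_mem (hR1 hx), ← sub_mul, enorm_mul, mul_comm]
    gcongr
    rw [← ofReal_norm]
    exact ENNReal.ofReal_le_ofReal (hM x)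
  · simp [image_eq_zero_of_notMem_tsupport hx]

/-! ### The Poincaré lemma for locally integrable fields. -/

/-- The scalar form of the vanishing of the weak curl. -/
theorem HasWeakCurl.integral_mul_partialDeriv_comm {F : E3 → E3} (h : HasWeakCurl F 0)
    (hF : LocallyIntegrable F) {u : E3 → ℝ} (hu : ContDiff ℝ ∞ u) (hu' : HasCompactSupport u)
    (i j : Fin 3) : ∫ x, F x i * partialDeriv j u x = ∫ x, F x j * partialDeriv i u x := by
  have hint : ∀ a b, Integrable fun x => F x a * partialDeriv b u x := fun a b =>
    (locallyIntegrable_component hF a).integrable_mul_of_hasCompactSupport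
      (continuous_partialDeriv b hu) (hasCompactSupport_partialDeriv b hu')
  have h0 : ∀ i, partialDeriv i (fun _ : E3 => (0 : ℝ)) = 0 := fun i => by
    ext x
    simp [partialDeriv]
  have hneg : ∀ a b x, F x a * -partialDeriv b u x = -(F x a * partialDeriv b u x) :=
    fun a b x => by ring
  -- Testing with `u e_l` isolates the `l`-th component of the curl.
  have hs : ∀ l : Fin 3, ContDiff ℝ ∞ fun x => u x • EuclideanSpace.single l (1 : ℝ) :=
    fun l => hu.smul contDiff_const
  have hc : ∀ l : Fin 3, HasCompactSupport fun x => u x • EuclideanSpace.single l (1 : ℝ) :=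
    fun l => hu'.smul_right
  have e : ∀ l : Fin 3, ∫ x, inner ℝ (F x)
      (curl (fun x => u x • EuclideanSpace.single l (1 : ℝ)) x) = 0 := fun l => by
    simpa using h _ (hs l) (hc l)
  have key : ∀ a b c d, ∫ x, (F x a * partialDeriv b u x + -(F x c * partialDeriv d u x)) =
      (∫ x, F x a * partialDeriv b u x) - ∫ x, F x c * partialDeriv d u x := fun a b c d => by
    rw [← integral_sub (hint a b) (hint c d)]
    simp_rw [sub_eq_add_neg]
  have e01 : ∫ x, F x 0 * partialDeriv 1 u x = ∫ x, F x 1 * partialDeriv 0 u x := by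
    have := e 2
    simp only [inner_eq_add_add, curl, PiLp.smul_apply, smul_eq_mul] at this
    simp [h0, hneg] at this
    exact sub_eq_zero.1 ((key 0 1 1 0).symm.trans this)
  have e02 : ∫ x, F x 0 * partialDeriv 2 u x = ∫ x, F x 2 * partialDeriv 0 u x := by
    have := e 1
    simp only [inner_eq_add_add, curl, PiLp.smul_apply, smul_eq_mul] at this
    simp [h0, hneg] at this
    refine (sub_eq_zero.1 ((key 2 0 0 2).symm.trans ?_)).symm
    rw [← this]
    congr 1 with x
    exact add_comm _ _
  have e12 : ∫ x, F x 1 * partialDeriv 2 u x = ∫ x, F x 2 * partialDeriv 1 u x := by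
    have := e 0
    simp only [inner_eq_add_add, curl, PiLp.smul_apply, smul_eq_mul] at this
    simp [h0, hneg] at this
    exact sub_eq_zero.1 ((key 1 2 2 1).symm.trans this)
  fin_cases i <;> fin_cases j
  exacts [rfl, e01, e02, e01.symm, rfl, e12, e02.symm, e12.symm, rfl]

/-- The weak identity is tested with the reflected mollifier `t ↦ mollifier k (x - t)`; the sign
from the chain rule occurs on both sides. -/
theorem HasWeakCurl.partialDeriv_mollify_symm {F : E3 → E3} (h : HasWeakCurl F 0)
    (hF : LocallyIntegrable F) (k : ℕ) (i j : Fin 3) (x : E3) :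
    partialDeriv i (mollify k fun y => F y j) x = partialDeriv j (mollify k fun y => F y i) x := by
  rw [partialDeriv_mollify i k (locallyIntegrable_component hF j),
    partialDeriv_mollify j k (locallyIntegrable_component hF i)]
  have hu : ContDiff ℝ ∞ fun t => mollifier k (x - t) :=
    (contDiff_mollifier k).comp (contDiff_const.sub contDiff_id)
  have hu' : HasCompactSupport fun t => mollifier k (x - t) :=
    (hasCompactSupport_mollifier k).comp_homeomorph (Homeomorph.subLeft x)
  have hd : ∀ i t, partialDeriv i (fun t => mollifier k (x - t)) t =
      -partialDeriv i (mollifier k) (x - t) := fun i t => by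
    have h1 : HasFDerivAt (fun t => x - t) (-ContinuousLinearMap.id ℝ E3) t :=
      (hasFDerivAt_id t).const_sub x
    have h2 := ((contDiff_mollifier k).differentiable (by simp) (x - t)).hasFDerivAt.comp t h1
    rw [partialDeriv, show (fun t => mollifier k (x - t)) = mollifier k ∘ fun t => x - t from rfl,
      h2.fderiv]
    simp [partialDeriv]
  have := h.integral_mul_partialDeriv_comm hF hu hu' j i
  simp_rw [hd, mul_neg, integral_neg] at this
  exact neg_injective this

/-- Mollifying keeps the field curl free, so the identity holds for each smooth approximation by the
classical Poincaré lemma. Both sides are continuous for `L¹` convergence on balls, the left one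
through `lintegral_homotopyOp_sub_le`. -/
theorem HasWeakCurl.integral_homotopyOp_mul {F : E3 → E3} (h : HasWeakCurl F 0)
    (hF : LocallyIntegrable F) (hFm : Measurable F) {η : E3 → ℝ} (hη : ContDiff ℝ ∞ η)
    (hη' : HasCompactSupport η) (i : Fin 3) :
    ∫ x, homotopyOp F x * partialDeriv i η x =
      -(volume.real (Metric.ball (0 : E3) 1) * ∫ x, F x i * η x) := by
  set G : ℕ → E3 → E3 := fun k x => WithLp.toLp 2 fun j => mollify k (fun y => F y j) x with hG
  have hGs : ∀ k, ContDiff ℝ ∞ (G k) := fun k => contDiff_euclidean.2 fun j =>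
    contDiff_mollify k (locallyIntegrable_component hF j)
  have hGl : ∀ k, LocallyIntegrable (G k) := fun k => (hGs k).continuous.locallyIntegrable
  have heq : ∀ k, ∫ x, homotopyOp (G k) x * partialDeriv i η x =
      -(volume.real (Metric.ball (0 : E3) 1) * ∫ x, G k x i * η x) := fun k => by
    obtain ⟨φ, hφ⟩ := exists_hasFDerivAt_of_partialDeriv_symm (hGs k)
      (fun i j x => h.partialDeriv_mollify_symm hF k i j x)
    exact integral_homotopyOp_mul_of_primitive (hGs k).continuous hφ hη hη' i
  have hcomp : ∀ j R, Tendsto (fun k => ∫⁻ x in Metric.ball 0 R, ‖G k x j - F x j‖ₑ) atTop (𝓝 0) :=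
    fun j R => tendsto_lintegral_mollify_sub (locallyIntegrable_component hF j) R
  have hvec : ∀ R, Tendsto (fun k => ∫⁻ x in Metric.ball 0 R, ‖G k x - F x‖ₑ) atTop (𝓝 0) :=
    fun R => by
    have hsum := ((hcomp 0 R).add (hcomp 1 R)).add (hcomp 2 R)
    simp only [add_zero] at hsum
    refine tendsto_of_tendsto_of_tendsto_of_le_of_le tendsto_const_nhds hsum (fun k => zero_le)
      fun k => ?_
    have hme : ∀ j, AEMeasurable (fun x => ‖G k x j - F x j‖ₑ)
        (volume.restrict (Metric.ball 0 R)) := fun j =>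
      ((contDiff_euclidean.1 (hGs k) j).continuous.aestronglyMeasurable.sub
        (locallyIntegrable_component hF j).aestronglyMeasurable).enorm.restrict
    simp only
    rw [← lintegral_add_left' (hme 0), ← lintegral_add_left' (f := fun x => ‖G k x 0 - F x 0‖ₑ + ‖G k x 1 - F x 1‖ₑ)
      ((hme 0).add (hme 1))]
    refine lintegral_mono fun x => ?_
    exact enorm_le_add_add (G k x - F x)
  have hop : ∀ R : ℝ, 1 ≤ R → Tendsto (fun k => ∫⁻ x in Metric.ball 0 R,
      ‖homotopyOp (G k) x - homotopyOp F x‖ₑ) atTop (𝓝 0) := fun R hR => by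
    have h0 : Tendsto (fun k => homotopyConst R * ∫⁻ x in Metric.ball 0 R, ‖G k x - F x‖ₑ)
        atTop (𝓝 0) := by
      simpa using ENNReal.Tendsto.const_mul (hvec R) (Or.inr (homotopyConst_lt_top R).ne)
    exact tendsto_of_tendsto_of_tendsto_of_le_of_le tendsto_const_nhds h0 (fun k => zero_le)
      fun k => lintegral_homotopyOp_sub_le (hGs k).continuous.measurable (hGl k) hFm hF hR
  have hL := tendsto_integral_mul_of_tendsto_lintegral_ball
    (fun k => locallyIntegrable_homotopyOp (hGs k).continuous.measurable (hGl k))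
    (locallyIntegrable_homotopyOp hFm hF) hop (continuous_partialDeriv i hη)
    (hasCompactSupport_partialDeriv i hη')
  have hR := tendsto_integral_mul_of_tendsto_lintegral_ball
    (fun k => locallyIntegrable_component (hGl k) i) (locallyIntegrable_component hF i)
    (fun R _ => hcomp i R) hη.continuous hη'
  simp_rw [heq] at hL
  exact tendsto_nhds_unique hL (hR.const_mul _).neg

/-- The Poincaré lemma for locally integrable vector fields on `ℝ³`. -/
theorem HasWeakCurl.exists_primitive {F : E3 → E3} (h : HasWeakCurl F 0)
    (hF : LocallyIntegrable F) :
    ∃ φ : E3 → ℝ, LocallyIntegrable φ ∧ ∀ η : E3 → ℝ, ContDiff ℝ ∞ η → HasCompactSupport η →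
      ∀ i, ∫ x, φ x * partialDeriv i η x = -∫ x, F x i * η x := by
  -- The estimates for `homotopyOp` are stated for genuinely measurable fields. Changing `F` on a
  -- null set affects neither the hypothesis nor the conclusion, which only involve integrals.
  obtain ⟨F', hF'm, hFF'⟩ := hF.aestronglyMeasurable
  have hF' : LocallyIntegrable F' := hF.congr hFF'
  have h' : HasWeakCurl F' 0 := fun Φ hΦ hΦ' => by
    rw [← h Φ hΦ hΦ']
    refine integral_congr_ae ?_
    filter_upwards [hFF'] with x hx
    rw [hx]
  set V := volume.real (Metric.ball (0 : E3) 1) with hV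
  have hV0 : V ≠ 0 := (ENNReal.toReal_pos (Metric.measure_ball_pos _ _ one_pos).ne'
    measure_ball_lt_top.ne).ne'
  refine ⟨fun x => V⁻¹ * homotopyOp F' x,
    (locallyIntegrable_homotopyOp hF'm.measurable hF').smul V⁻¹, fun η hη hη' i => ?_⟩
  simp_rw [mul_assoc]
  rw [integral_const_mul, h'.integral_homotopyOp_mul hF' hF'm.measurable hη hη' i, ← hV, mul_neg,
    inv_mul_cancel_left₀ hV0]
  congr 1
  refine integral_congr_ae ?_
  filter_upwards [hFF'] with x hx
  rw [hx]

/-! ### Comparison of the gauge seminorm with the Biot–Savart field. -/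

theorem continuous_curl {Φ : E3 → E3} (hΦ : ContDiff ℝ ∞ Φ) : Continuous (curl Φ) := by
  have h : ∀ i j, Continuous (partialDeriv i fun y => Φ y j) := fun i j =>
    continuous_partialDeriv i (contDiff_component hΦ j)
  refine (PiLp.continuous_toLp 2 _).comp (continuous_pi fun i => ?_)
  fin_cases i
  exacts [(h 1 2).sub (h 2 1), (h 2 0).sub (h 0 2), (h 0 1).sub (h 1 0)]

theorem hasCompactSupport_curl {Φ : E3 → E3} (hΦ : HasCompactSupport Φ) :
    HasCompactSupport (curl Φ) := by
  refine hΦ.mono' fun x hx => ?_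
  by_contra hx'
  have hz : ∀ i j, partialDeriv i (fun y => Φ y j) x = 0 := fun i j => by
    rw [partialDeriv, fderiv_of_notMem_tsupport ℝ fun h => hx' ?_]
    · rfl
    · exact closure_mono (Function.support_comp_subset (g := fun v : E3 => v j) rfl Φ) h
  refine hx ?_
  ext i
  fin_cases i <;> simp [curl, hz]

theorem integrable_inner_of_hasCompactSupport {A Ψ : E3 → E3} (hA : LocallyIntegrable A)
    (hΨ : Continuous Ψ) (hΨ' : HasCompactSupport Ψ) :
    Integrable fun x => inner ℝ (A x) (Ψ x) := by
  simp_rw [inner_eq_add_add]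
  have h : ∀ i, Integrable fun x => A x i * Ψ x i := fun i =>
    (locallyIntegrable_component hA i).integrable_mul_of_hasCompactSupport
      ((EuclideanSpace.proj (𝕜 := ℝ) i).continuous.comp hΨ) (hasCompactSupport_component hΨ' i)
  exact ((h 0).add (h 1)).add (h 2)

theorem HasWeakCurl.sub {A A' B B' : E3 → E3} (h : HasWeakCurl A B) (h' : HasWeakCurl A' B')
    (hA : LocallyIntegrable A) (hA' : LocallyIntegrable A') (hB : LocallyIntegrable B)
    (hB' : LocallyIntegrable B') : HasWeakCurl (A - A') (B - B') := by
  intro Φ hΦ hΦ'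
  simp only [Pi.sub_apply, inner_sub_left]
  rw [integral_sub
      (integrable_inner_of_hasCompactSupport hA (continuous_curl hΦ) (hasCompactSupport_curl hΦ'))
      (integrable_inner_of_hasCompactSupport hA' (continuous_curl hΦ) (hasCompactSupport_curl hΦ')),
    integral_sub (integrable_inner_of_hasCompactSupport hB hΦ.continuous hΦ')
      (integrable_inner_of_hasCompactSupport hB' hΦ.continuous hΦ'), h Φ hΦ hΦ', h' Φ hΦ hΦ']

theorem HasWeakCurl.congr {A B B' : E3 → E3} (h : HasWeakCurl A B) (hB : B =ᵐ[volume] B') :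
    HasWeakCurl A B' := fun Φ hΦ hΦ' => by
  rw [h Φ hΦ hΦ']
  refine integral_congr_ae ?_
  filter_upwards [hB] with x hx
  rw [hx]

theorem memLp_biotSavart {C : E3 → E3} (hm : ∀ k, AEStronglyMeasurable fun y => C y k)
    (hfin : ∀ k, ∫⁻ y, ‖C y k‖ₑ ^ (3 / 2 : ℝ) < ⊤) {S : Set E3} (hS : volume S < ⊤) :
    MemLp (biotSavart C) 2 (volume.restrict S) := by
  have h : ∀ j k, MemLp (newtonPot j fun y => C y k) 2 (volume.restrict S) := fun j k =>
    memLp_newtonPot j (hm k) (hfin k) hS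
  refine MemLp.of_eval_piLp fun i => ?_
  fin_cases i
  exacts [(h 2 1).sub (h 1 2), (h 0 2).sub (h 2 0), (h 1 0).sub (h 0 1)]

theorem locallyIntegrable_biotSavart {C : E3 → E3}
    (hm : ∀ k, AEStronglyMeasurable fun y => C y k)
    (hfin : ∀ k, ∫⁻ y, ‖C y k‖ₑ ^ (3 / 2 : ℝ) < ⊤) : LocallyIntegrable (biotSavart C) := by
  intro x
  have : IsFiniteMeasure (volume.restrict (Metric.ball x 1)) := ⟨by simp⟩
  exact ⟨Metric.ball x 1, Metric.ball_mem_nhds x one_pos,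
    (memLp_biotSavart hm hfin measure_ball_lt_top).integrable (by norm_num)⟩

/-- The gauge seminorm of a field in `L²(Ω)` is controlled by the `L²(Ω)` norm of the Biot–Savart
field of its curl. -/
theorem localGaugeSeminorm_le_eLpNorm_biotSavart {D C : E3 → E3} (hD : LocallyIntegrable D)
    (h : HasWeakCurl D C) (hC : LocallyIntegrable C)
    (hfin : ∀ k, ∫⁻ y, ‖C y k‖ₑ ^ (3 / 2 : ℝ) < ⊤) {Ω : Set E3} (hΩfin : volume Ω < ⊤)
    (hL2 : MemLp D 2 (volume.restrict Ω)) :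
    localGaugeSeminorm Ω D ≤ eLpNorm (biotSavart C) 2 (volume.restrict Ω) := by
  have hm : ∀ k, AEStronglyMeasurable fun y => C y k := fun k =>
    (locallyIntegrable_component hC k).aestronglyMeasurable
  have hbs := locallyIntegrable_biotSavart hm hfin
  have hcurl : HasWeakCurl (D - biotSavart C) 0 := by
    rw [← sub_self C]
    exact h.sub (h.biotSavart hm hfin) hD hbs hC hC
  obtain ⟨φ, hφ, hgrad⟩ := hcurl.exists_primitive (hD.sub hbs)
  have hdot : IsDotH1WithGrad Ω φ (D - biotSavart C) := by
    refine ⟨hφ.locallyIntegrableOn Ω, hL2.sub (memLp_biotSavart hm hfin hΩfin),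
      fun η hη hη' hsupp i => ?_⟩
    -- Since `η` is supported in `Ω`, both integrals may be extended to ℝ³, where the primitive was
    -- built.
    rw [setIntegral_eq_integral_of_forall_compl_eq_zero fun x hx => ?_,
      setIntegral_eq_integral_of_forall_compl_eq_zero fun x hx => ?_]
    · exact hgrad η hη hη' i
    · rw [image_eq_zero_of_notMem_tsupport fun hx' => hx (hsupp hx'), mul_zero]
    · rw [partialDeriv, fderiv_of_notMem_tsupport ℝ fun hx' => hx (hsupp hx')]
      exact mul_zero _
  refine (iInf₂_le φ (D - biotSavart C)).trans ((iInf_le _ hdot).trans_eq ?_)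
  rw [sub_sub_cancel]

theorem tendsto_eLpNorm_biotSavart {C : ℕ → E3 → E3} {S : Set E3}
    (hm : ∀ n k, AEStronglyMeasurable fun y => C n y k)
    (hlim : ∀ j k, Tendsto (fun n => ∫⁻ x in S, ‖newtonPot j (fun y => C n y k) x‖ₑ ^ (2 : ℝ))
      atTop (𝓝 0)) :
    Tendsto (fun n => eLpNorm (biotSavart (C n)) 2 (volume.restrict S)) atTop (𝓝 0) := by
  have hN : ∀ j k, Tendsto (fun n => eLpNorm (newtonPot j fun y => C n y k) 2 (volume.restrict S))
      atTop (𝓝 0) := fun j k => by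
    have h := (hlim j k).ennrpow_const (1 / 2 : ℝ)
    rw [ENNReal.zero_rpow_of_pos (by norm_num)] at h
    refine h.congr fun n => ?_
    rw [eLpNorm_eq_lintegral_rpow_enorm_toReal (by norm_num) (by norm_num)]
    simp
  have hpm : ∀ n j k, AEStronglyMeasurable (newtonPot j fun y => C n y k) (volume.restrict S) :=
    fun n j k => (aestronglyMeasurable_newtonPot j (hm n k)).restrict
  have hsq : ∀ n, eLpNorm (biotSavart (C n)) 2 (volume.restrict S) ≤
      eLpNorm (fun x => biotSavart (C n) x 0) 2 (volume.restrict S) +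
      eLpNorm (fun x => biotSavart (C n) x 1) 2 (volume.restrict S) +
      eLpNorm (fun x => biotSavart (C n) x 2) 2 (volume.restrict S) := fun n => by
    have hc : ∀ i, AEStronglyMeasurable (fun x => biotSavart (C n) x i) (volume.restrict S) :=
      fun i => by
      fin_cases i
      exacts [(hpm n 2 1).sub (hpm n 1 2), (hpm n 0 2).sub (hpm n 2 0),
        (hpm n 1 0).sub (hpm n 0 1)]
    calc _ ≤ eLpNorm ((fun x => ‖biotSavart (C n) x 0‖) + (fun x => ‖biotSavart (C n) x 1‖) +
          fun x => ‖biotSavart (C n) x 2‖) 2 (volume.restrict S) := by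
          refine eLpNorm_mono_enorm fun x => ?_
          rw [Pi.add_apply, Pi.add_apply, Real.enorm_of_nonneg (by positivity),
            ENNReal.ofReal_add (by positivity) (by positivity),
            ENNReal.ofReal_add (by positivity) (by positivity), ofReal_norm, ofReal_norm,
            ofReal_norm]
          exact enorm_le_add_add _
      _ ≤ _ := by
          refine (eLpNorm_add_le ((hc 0).norm.add (hc 1).norm) (hc 2).norm (by norm_num)).trans ?_
          refine add_le_add ((eLpNorm_add_le (hc 0).norm (hc 1).norm (by norm_num)).trans ?_) ?_
          · rw [eLpNorm_norm, eLpNorm_norm]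
          · rw [eLpNorm_norm]
  have hcomp : ∀ a b c d, Tendsto (fun n => eLpNorm (fun x => newtonPot a (fun y => C n y b) x -
      newtonPot c (fun y => C n y d) x) 2 (volume.restrict S)) atTop (𝓝 0) := fun a b c d => by
    have h := (hN a b).add (hN c d)
    rw [add_zero] at h
    exact tendsto_of_tendsto_of_tendsto_of_le_of_le tendsto_const_nhds h (fun n => zero_le)
      fun n => eLpNorm_sub_le (hpm n a b) (hpm n c d) (by norm_num)
  have hsum := ((hcomp 2 1 1 2).add (hcomp 0 2 2 0)).add (hcomp 1 0 0 1)
  simp only [add_zero] at hsum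
  exact tendsto_of_tendsto_of_tendsto_of_le_of_le tendsto_const_nhds hsum (fun n => zero_le) hsq

/-! ### Weak convergence in `L^{3/2}`. -/

theorem tendsto_apply_of_tendsto_toWeakSpace {E : Type*} [NormedAddCommGroup E] [NormedSpace ℝ E]
    {u : ℕ → E} {u₀ : E}
    (h : Tendsto (fun n => toWeakSpace ℝ E (u n)) atTop (𝓝 (toWeakSpace ℝ E u₀)))
    (L : E →L[ℝ] ℝ) : Tendsto (fun n => L (u n)) atTop (𝓝 (L u₀)) :=
  ((WeakBilin.eval_continuous (topDualPairing ℝ E).flip L).tendsto _).comp h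

/-- Weakly convergent sequences are bounded. -/
theorem exists_norm_le_of_tendsto_toWeakSpace {E : Type*} [NormedAddCommGroup E]
    [NormedSpace ℝ E] {u : ℕ → E} {u₀ : E}
    (h : Tendsto (fun n => toWeakSpace ℝ E (u n)) atTop (𝓝 (toWeakSpace ℝ E u₀))) :
    ∃ M, ∀ n, ‖u n‖ ≤ M := by
  -- Uniform boundedness is applied to evaluations on the dual space, which is complete whether or
  -- not `E` is; the embedding into the bidual is isometric.
  obtain ⟨M, hM⟩ := banach_steinhaus
    (g := fun n => NormedSpace.inclusionInDoubleDual ℝ E (u n)) fun L => by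
      obtain ⟨K, hK⟩ := (tendsto_apply_of_tendsto_toWeakSpace h L).norm.bddAbove_range
      exact ⟨K, fun n => hK ⟨n, rfl⟩⟩
  exact ⟨M, fun n => ((NormedSpace.inclusionInDoubleDualLi ℝ (E := E)).norm_map (u n)).symm.trans_le
    (hM n)⟩

instance holderConjugate_three_three_halves : ENNReal.HolderConjugate 3 (3 / 2) := by
  refine ⟨?_⟩
  rw [ENNReal.inv_div (Or.inl (by norm_num)) (Or.inl (by norm_num)), inv_one, div_eq_mul_inv,
    ← one_add_mul]
  norm_num
  exact ENNReal.mul_inv_cancel (by norm_num) (by norm_num)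

/-- Weak convergence in `L^{3/2}` gives convergence of the pairings of the components with
functions of `L³`. -/
theorem tendsto_integral_mul_of_tendsto_toWeakSpace
    {B : ℕ → Lp E3 (3 / 2 : ℝ≥0∞) (volume : Measure E3)}
    {B₀ : Lp E3 (3 / 2 : ℝ≥0∞) (volume : Measure E3)}
    (hweak : Tendsto
      (fun n => toWeakSpace ℝ (Lp E3 (3 / 2 : ℝ≥0∞) (volume : Measure E3)) (B n)) atTop
      (𝓝 (toWeakSpace ℝ (Lp E3 (3 / 2 : ℝ≥0∞) (volume : Measure E3)) B₀)))
    {h : E3 → ℝ} (hh : MemLp h 3) (k : Fin 3) :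
    Tendsto (fun n => ∫ y, h y * (B n - B₀ : Lp E3 (3 / 2 : ℝ≥0∞) volume) y k) atTop (𝓝 0) := by
  have : Fact ((1 : ℝ≥0∞) ≤ 3) := ⟨by norm_num⟩
  -- The functional is `v ↦ ∫ h v_k`, bounded on `L^{3/2}` by Hölder.
  set L := ((ContinuousLinearMap.lsmul ℝ ℝ).flip
    (EuclideanSpace.proj (𝕜 := ℝ) k : E3 →L[ℝ] ℝ)).lpPairing (volume : Measure E3) 3 (3 / 2)
      (hh.toLp h) with hL
  have h1 := (tendsto_apply_of_tendsto_toWeakSpace hweak L).sub_const (L B₀)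
  rw [sub_self] at h1
  refine h1.congr fun n => ?_
  rw [← map_sub, hL, ContinuousLinearMap.lpPairing_eq_integral]
  refine integral_congr_ae ?_
  filter_upwards [hh.coeFn_toLp] with y hy
  rw [hy]
  simp

/-- For each fixed `x` this makes the truncated kernel an admissible test function for weak
`L^{3/2}` convergence. -/
theorem memLp_farKernel (j : Fin 3) {r : ℝ} (hr : 0 < r) (x : E3) :
    MemLp (fun y => farKernel j r (x - y)) 3 := by
  refine ⟨((measurable_farKernel j r).comp
    (measurable_const.sub measurable_id)).aestronglyMeasurable, ?_⟩
  rw [eLpNorm_lt_top_iff_lintegral_rpow_enorm_lt_top (by norm_num) (by norm_num)]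
  simp only [ENNReal.toReal_ofNat]
  rw [lintegral_sub_left_eq_self (fun y => ‖farKernel j r y‖ₑ ^ (3 : ℝ)) x]
  exact lintegral_farKernel_lt_top j hr

theorem lintegral_component_rpow_le (u : Lp E3 (3 / 2 : ℝ≥0∞) (volume : Measure E3)) (k : Fin 3) :
    ∫⁻ y, ‖u y k‖ₑ ^ (3 / 2 : ℝ) ≤ ENNReal.ofReal ‖u‖ ^ (3 / 2 : ℝ) := by
  have htop : (3 / 2 : ℝ≥0∞) ≠ ⊤ := ENNReal.div_ne_top (by norm_num) (by norm_num)
  have hto : (3 / 2 : ℝ≥0∞).toReal = 3 / 2 := by simp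
  rw [ofReal_norm, Lp.enorm_def, eLpNorm_eq_lintegral_rpow_enorm_toReal
    (ENNReal.div_pos (by norm_num) (by norm_num)).ne' htop, hto, ← ENNReal.rpow_mul,
    show (1 / (3 / 2) * (3 / 2) : ℝ) = 1 by norm_num, ENNReal.rpow_one]
  gcongr with y
  rw [← ofReal_norm, ← ofReal_norm]
  exact ENNReal.ofReal_le_ofReal (PiLp.norm_apply_le _ _)

theorem proposition5
    (A : ℕ → E3 → E3) (A₀ : E3 → E3)
    (hA : ∀ n, LocallyIntegrable (A n) volume) (hA₀ : LocallyIntegrable A₀ volume)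
    (B : ℕ → Lp E3 (3 / 2 : ℝ≥0∞) (volume : Measure E3))
    (B₀ : Lp E3 (3 / 2 : ℝ≥0∞) (volume : Measure E3))
    (hB : ∀ n, HasWeakCurl (A n) (B n)) (hB₀ : HasWeakCurl A₀ B₀)
    (hweak : Tendsto
      (fun n => toWeakSpace ℝ (Lp E3 (3 / 2 : ℝ≥0∞) (volume : Measure E3)) (B n)) atTop
      (𝓝 (toWeakSpace ℝ (Lp E3 (3 / 2 : ℝ≥0∞) (volume : Measure E3)) B₀)))
    (Ω : Set E3) (hΩ : IsOpen Ω) (hΩfin : volume Ω < ⊤)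
    (hL2 : ∀ n, MemLp (A n - A₀) 2 (volume.restrict Ω)) :
    Tendsto (fun n => localGaugeSeminorm Ω (A n - A₀)) atTop (𝓝 0) := by
  set C : ℕ → E3 → E3 := fun n => ⇑(B n - B₀ : Lp E3 (3 / 2 : ℝ≥0∞) (volume : Measure E3)) with hC
  have hloc : ∀ u : Lp E3 (3 / 2 : ℝ≥0∞) (volume : Measure E3), LocallyIntegrable u := fun u =>
    (Lp.memLp u).locallyIntegrable fact_one_le_three_halves.out
  have hCm : ∀ n k, AEStronglyMeasurable fun y => C n y k := fun n k =>
    (locallyIntegrable_component (hloc _) k).aestronglyMeasurable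
  obtain ⟨M, hM⟩ := exists_norm_le_of_tendsto_toWeakSpace hweak
  have hbound : ∀ n k, ∫⁻ y, ‖C n y k‖ₑ ^ (3 / 2 : ℝ) ≤
      ENNReal.ofReal (M + ‖B₀‖) ^ (3 / 2 : ℝ) := fun n k => by
    refine (lintegral_component_rpow_le _ k).trans ?_
    gcongr
    exact (norm_sub_le _ _).trans (by gcongr; exact hM n)
  have hKtop : ENNReal.ofReal (M + ‖B₀‖) ^ (3 / 2 : ℝ) < ⊤ :=
    ENNReal.rpow_lt_top_of_nonneg (by norm_num) ENNReal.ofReal_ne_top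
  have hcurl : ∀ n, HasWeakCurl (A n - A₀) (C n) := fun n =>
    ((hB n).sub hB₀ (hA n) hA₀ (hloc _) (hloc _)).congr (Lp.coeFn_sub _ _).symm
  -- The seminorm is squeezed between `0` and the `L²(Ω)` norm of the Biot–Savart field of `C n`.
  refine tendsto_of_tendsto_of_tendsto_of_le_of_le tendsto_const_nhds
    (tendsto_eLpNorm_biotSavart (S := Ω) hCm fun j k => ?_) (fun n => zero_le) fun n =>
      localGaugeSeminorm_le_eLpNorm_biotSavart ((hA n).sub hA₀) (hcurl n) (hloc _)
        (fun k => (hbound n k).trans_lt hKtop) hΩfin (hL2 n)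
  exact tendsto_setLIntegral_newtonPot j (fun n => hCm n k) hKtop (fun n => hbound n k)
    (fun r hr x => tendsto_integral_mul_of_tendsto_toWeakSpace hweak (memLp_farKernel j hr x) k)
    hΩfin
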